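/- **Setting.** Let $d\ge 1$, let $\mathcal P$ be the set of probability vectors $(p_z)_{z\in\mathbb Z^d}$, with the $\sigma$-field generated by the coordinates, and let $\Omega=\mathcal P^{\mathbb Z^d}$ carry the product $\sigma$-field $\mathfrak S$. An environment $\omega\in\Omega$ is written $\omega_x=(\pi_{x,x+y}(\omega))_{y\in\mathbb Z^d}$, and the shifts $T_z$ are given by $\pi_{x,y}(T_z\omega)=\pi_{x+z,y+z}(\omega)$. For $\omega\in\Omega$ let $P_z^\omega$ be the law of the Markov chain $(X_n)_{n\ge0}$ on $\mathbb Z^d$ with $X_0=z$ and transition probabilities $\pi_{x,y}(\omega)$. For a probability measure $\mathbb P$ on $(\Omega,\mathfrak S)$ let $P_z(dX,d\omega)=P_z^\omega(dX)\,\mathbb P(d\omega)$. Let $\hat\pi(\omega,A)=P_0^\omega(T_{X_1}\omega\in A)$, a Markov kernel on $\Omega$. For a vector $\hat u\in\mathbb R^d$ and $k\in\mathbb Z$ let $\mathfrak S_k=\sigma(\omega_x: x\cdot\hat u\ge k)$, and let $|\cdot|$ be the $\ell^1$-norm on $\mathbb Z^d$. **Theorem.** Let $\mathbb P$ be an i.i.d.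 product measure on $\Omega=\mathcal P^{\mathbb Z^d}$ and let $\hat u\in\mathbb R^d\setminus\{0\}$. Assume: * (forbidden direction $-\hat u$) $\mathbb P\big(\sum_{z:\,z\cdot\hat u\ge0}\pi_{0,z}=1\big)=1$; * (N) there is a constant $\delta>0$ with $\mathbb P\big(\sum_z (z\cdot\hat u)\,\pi_{0,z}\ge\delta\big)=1$; * (M) with an exponent $p>1$: there is a constant $M>0$ with $\mathbb P\big(\sum_z|z|^p\pi_{0,z}\le M^p\big)=1$. Then there is a probability measure $\mathbb P_\infty$ on $(\Omega,\mathfrak S)$ that is invariant for the kernel $\hat\pi$ and has the following properties. (a) For every integer $k\le0$, $\mathbb P_\infty$ is absolutely continuous with respect to $\mathbb P$ on $\mathfrak S_k$. Moreover $\mathbb P_\infty=\mathbb P$ on $\mathfrak S_1$, and $\mathbb P$ and $\mathbb P_\infty$ are mutually absolutely continuous on $\mathfrak S_0$. (b) The Markov process with kernel $\hat\pi$ and initial distribution $\mathbb P_\infty$ is ergodic: its law on $\Omega^{\{0,1,2,\dots\}}$ is invariant and ergodic under the time shift. (c) $\mathbb P_\infty$ is the only probability measure on $(\Omega,\mathfrak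 S)$ that is invariant for $\hat\pi$, is absolutely continuous with respect to $\mathbb P$ on $\mathfrak S_k$ for all $k\le0$, and satisfies (b). Moreover, with $\mathbb P_n(A)=P_0(T_{X_n}\omega\in A)$, we have $\mathbb P_n(A)\to\mathbb P_\infty(A)$ as $n\to\infty$ for every $A\in\mathfrak S_k$ and every integer $k\le0$. -/

import Mathlib

open MeasureTheory ProbabilityTheory Filter Topology
open scoped ENNReal

namespace RWRE

noncomputable section

/-! ### Markov chains on a general state space -/

/-- The law on `ℕ → S` of the time-homogeneous Markov chain with transition kernel `κ`, as a
kernel in the initial state. -/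
def markovLaw {S : Type*} [MeasurableSpace S] (κ : Kernel S S) [IsMarkovKernel κ] :
    Kernel S (ℕ → S) :=
  (Kernel.traj (X := fun _ : ℕ => S)
    (fun n => κ.comap (fun h : (i : Finset.Iic n) → S => h ⟨n, Finset.mem_Iic.2 le_rfl⟩)
      (measurable_pi_apply _)) 0).comap (fun x _ => x) (measurable_pi_lambda _ fun _ => measurable_id)

instance {S : Type*} [MeasurableSpace S] (κ : Kernel S S) [IsMarkovKernel κ] :
    IsMarkovKernel (markovLaw κ) := by
  unfold markovLaw; infer_instance

lemma markovLaw_map_zero {S : Type*} [MeasurableSpace S] (κ : Kernel S S) [IsMarkovKernel κ]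
    (x : S) : (markovLaw κ x).map (fun X => X 0) = Measure.dirac x := by
  unfold markovLaw
  rw [Kernel.comap_apply]
  have hm : Measurable (fun h : (i : Finset.Iic 0) → S => h ⟨0, Finset.mem_Iic.2 le_rfl⟩) :=
    measurable_pi_apply _
  have h := congrArg (fun μ => μ.map (fun h : (i : Finset.Iic 0) → S =>
      h ⟨0, Finset.mem_Iic.2 le_rfl⟩))
    (Kernel.traj_map_frestrictLe_apply (X := fun _ : ℕ => S)
      (κ := fun n => κ.comap (fun h : (i : Finset.Iic n) → S => h ⟨n, Finset.mem_Iic.2 le_rfl⟩)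
        (measurable_pi_apply _)) 0 0 (fun _ => x))
  simp only [Kernel.partialTraj_self, Kernel.id_apply] at h
  rw [Measure.map_map hm (Preorder.measurable_frestrictLe 0)] at h
  exact h.trans (Measure.map_dirac' hm _)

lemma markovLaw_map_one {S : Type*} [MeasurableSpace S] (κ : Kernel S S) [IsMarkovKernel κ]
    (x : S) : (markovLaw κ x).map (fun X => X 1) = κ x := by
  unfold markovLaw
  rw [Kernel.comap_apply, ← Kernel.map_apply _ (measurable_pi_apply 1)]
  have h := Kernel.map_traj_succ_self (X := fun _ : ℕ => S)
    (κ := fun n => κ.comap (fun h : (i : Finset.Iic n) → S => h ⟨n, Finset.mem_Iic.2 le_rfl⟩)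
      (measurable_pi_apply _)) (a := 0)
  simp only [zero_add] at h
  rw [h, Kernel.comap_apply]

/-! ### Environments -/

/-- Sites of the lattice `ℤ^d`. -/
abbrev Site (d : ℕ) := Fin d → ℤ

/-- The σ-field on the simplex of probability vectors generated by the coordinates. -/
instance instMeasurableSpacePMF {α : Type*} : MeasurableSpace (PMF α) :=
  MeasurableSpace.comap (fun (p : PMF α) (a : α) => p a) MeasurableSpace.pi

/-- Environments: `ω x` is the law of the jump `y` made from site `x`. The σ-field is the product
σ-field. -/
abbrev Env (d : ℕ) := Site d → PMF (Site d)

/-- The transition probability from `x` to `y` in the environment `ω`. -/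
def jump {d : ℕ} (ω : Env d) (x y : Site d) : ℝ≥0∞ := ω x (y - x)

/-- The shift `T_z` of environments: `π_{x,y}(T_z ω) = π_{x+z,y+z}(ω)`. -/
def shift {d : ℕ} (z : Site d) (ω : Env d) : Env d := fun x => ω (x + z)

lemma jump_shift {d : ℕ} (ω : Env d) (x y z : Site d) :
    jump (shift z ω) x y = jump ω (x + z) (y + z) := by
  simp [jump, shift]

lemma measurable_pmf_apply {α : Type*} (a : α) : Measurable (fun p : PMF α => p a) :=
  (measurable_pi_apply a).comp (comap_measurable _)

lemma measurable_shift {d : ℕ} :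
    Measurable (fun q : Env d × Site d => shift q.2 q.1) := by
  refine measurable_from_prod_countable_left fun z => ?_
  exact measurable_pi_lambda _ fun x => measurable_pi_apply (x + z)

/-! ### The walk in a fixed environment -/

/-- The transition kernel of the walk in the environment `ω`: from `x` it moves to `x + z` with
probability `ω x z`. -/
def walkKernel {d : ℕ} (ω : Env d) : Kernel (Site d) (Site d) where
  toFun x := (ω x).toMeasure.map (fun z => x + z)
  measurable' := Measurable.of_discrete

instance {d : ℕ} (ω : Env d) : IsMarkovKernel (walkKernel ω) :=
  ⟨fun _ => Measure.isProbabilityMeasure_map Measurable.of_discrete.aemeasurable⟩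

lemma walkKernel_singleton {d : ℕ} (ω : Env d) (x y : Site d) :
    walkKernel ω x {y} = jump ω x y := by
  change ((ω x).toMeasure.map (fun z => x + z)) {y} = _
  rw [Measure.map_apply Measurable.of_discrete (measurableSet_singleton y)]
  have : (fun z => x + z) ⁻¹' {y} = {y - x} := by
    ext z
    simp only [Set.mem_preimage, Set.mem_singleton_iff]
    constructor
    · rintro rfl; simp
    · rintro rfl; simp
  rw [this, PMF.toMeasure_apply_singleton _ _ (measurableSet_singleton _)]
  rfl

lemma measurable_walkKernel {d : ℕ} (x : Site d) (s : Set (Site d)) :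
    Measurable (fun ω : Env d => walkKernel ω x s) := by
  have h : ∀ ω : Env d, walkKernel ω x s =
      ∑' z, ((fun z => x + z) ⁻¹' s).indicator (ω x) z := fun ω => by
    change ((ω x).toMeasure.map (fun z => x + z)) s = _
    rw [Measure.map_apply Measurable.of_discrete (MeasurableSet.of_discrete),
      PMF.toMeasure_apply _ (MeasurableSet.of_discrete)]
  simp_rw [h]
  refine Measurable.tsum fun z => ?_
  by_cases hz : z ∈ (fun z => x + z) ⁻¹' s
  · simp only [Set.indicator_of_mem hz]
    exact (measurable_pmf_apply z).comp (measurable_pi_apply x)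
  · simp only [Set.indicator_of_notMem hz]
    exact measurable_const

lemma partialTraj_succ_apply {X : ℕ → Type*} [∀ n, MeasurableSpace (X n)]
    (κ : (n : ℕ) → Kernel ((i : Finset.Iic n) → X i) (X (n + 1))) [∀ n, IsMarkovKernel (κ n)]
    (n : ℕ) (y : (i : Finset.Iic n) → X i) {s : Set ((i : Finset.Iic (n + 1)) → X i)}
    (hs : MeasurableSet s) :
    Kernel.partialTraj κ n (n + 1) y s = κ n y ((fun t => IicProdIoc n (n + 1)
      (y, MeasurableEquiv.piSingleton n t)) ⁻¹' s) := by
  rw [Kernel.partialTraj_succ_self, Kernel.map_apply' _ measurable_IicProdIoc _ hs,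
    Kernel.prod_apply, Kernel.id_apply, Measure.dirac_prod,
    Measure.map_apply measurable_prodMk_left (measurable_IicProdIoc hs),
    Kernel.map_apply' _ (MeasurableEquiv.measurable _) _
      (measurable_prodMk_left (measurable_IicProdIoc hs))]
  rfl

/-- The quenched law of finite pieces of the walk depends measurably on the environment. -/
lemma measurable_partialTraj_walk {d : ℕ} (z : Site d) (N : ℕ)
    (s : Set ((i : Finset.Iic N) → Site d)) :
    Measurable (fun ω : Env d => Kernel.partialTraj (X := fun _ : ℕ => Site d)
      (fun n => (walkKernel ω).comap
        (fun h : (i : Finset.Iic n) → Site d => h ⟨n, Finset.mem_Iic.2 le_rfl⟩)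
        (measurable_pi_apply _)) 0 N (fun _ => z) s) := by
  induction N with
  | zero =>
    simp only [Kernel.partialTraj_self]
    exact measurable_const
  | succ N ih =>
    simp_rw [Kernel.partialTraj_succ_eq_comp (Nat.zero_le N)]
    simp_rw [Kernel.comp_apply' _ _ _ (MeasurableSet.of_discrete (s := s)),
      lintegral_countable']
    refine Measurable.tsum fun y => Measurable.mul ?_ (ih _)
    have h : ∀ ω : Env d, _ := fun ω =>
      partialTraj_succ_apply (X := fun _ : ℕ => Site d) (fun n => (walkKernel ω).comap
        (fun h : (i : Finset.Iic n) → Site d => h ⟨n, Finset.mem_Iic.2 le_rfl⟩)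
        (measurable_pi_apply _)) N y (MeasurableSet.of_discrete (s := s))
    rw [funext h]
    exact measurable_walkKernel (y ⟨N, Finset.mem_Iic.2 le_rfl⟩) _

/-- The quenched law `P_z^ω` on walk paths, as a kernel in the environment `ω`: the law of the
Markov chain on `ℤ^d` started at `z` with transition probabilities `π_{x,y}(ω)`. -/
def quenchedLaw {d : ℕ} (z : Site d) : Kernel (Env d) (ℕ → Site d) where
  toFun ω := markovLaw (walkKernel ω) z
  measurable' := by
    refine Measurable.measure_of_isPiSystem_of_isProbabilityMeasure
      (S := measurableCylinders (fun _ : ℕ => Site d)) generateFrom_measurableCylinders.symm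
      isPiSystem_measurableCylinders fun t ht => ?_
    obtain ⟨N, s, ms, rfl⟩ :
        ∃ N s, MeasurableSet s ∧ t = cylinder (α := fun _ : ℕ => Site d) (Finset.Iic N) s := by
      simpa [measurableCylinders_nat] using ht
    convert measurable_partialTraj_walk z N s using 2 with ω
    rw [← Kernel.traj_map_frestrictLe_apply,
      Measure.map_apply (Preorder.measurable_frestrictLe N) ms]
    rfl

instance {d : ℕ} (z : Site d) : IsMarkovKernel (quenchedLaw (d := d) z) :=
  ⟨fun ω => by change IsProbabilityMeasure (markovLaw (walkKernel ω) z); infer_instance⟩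

/-- The joint annealed law `P_z(dω, dX) = P(dω) P_z^ω(dX)`. -/
def annealedLaw {d : ℕ} (P : Measure (Env d)) (z : Site d) : Measure (Env d × (ℕ → Site d)) :=
  P ⊗ₘ quenchedLaw z

/-! ### The environment seen from the particle -/

/-- `T_{X_n} ω` as a function of the environment and the path. -/
def seenEnv {d : ℕ} (n : ℕ) (q : Env d × (ℕ → Site d)) : Env d := shift (q.2 n) q.1

lemma measurable_seenEnv {d : ℕ} (n : ℕ) : Measurable (seenEnv (d := d) n) :=
  measurable_shift.comp (g := fun r : Env d × Site d => shift r.2 r.1)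
    (f := fun q : Env d × (ℕ → Site d) => (q.1, q.2 n))
    (measurable_fst.prodMk ((measurable_pi_apply n).comp measurable_snd))

/-- The kernel `π̂(ω, A) = P_0^ω(T_{X_1} ω ∈ A)`; see `envKernel_apply`. -/
def envKernel (d : ℕ) : Kernel (Env d) (Env d) :=
  (Kernel.id ×ₖ quenchedLaw 0).map (seenEnv 1)

instance (d : ℕ) : IsMarkovKernel (envKernel d) :=
  Kernel.IsMarkovKernel.map _ (measurable_seenEnv 1)

lemma envKernel_apply {d : ℕ} (ω : Env d) {A : Set (Env d)} (hA : MeasurableSet A) :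
    envKernel d ω A = quenchedLaw 0 ω {X | shift (X 1) ω ∈ A} := by
  rw [envKernel, Kernel.map_apply' _ (measurable_seenEnv 1) _ hA, Kernel.prod_apply,
    Kernel.id_apply, Measure.dirac_prod,
    Measure.map_apply measurable_prodMk_left (measurable_seenEnv 1 hA)]
  rfl

/-- `P_n(A) = P_0(T_{X_n} ω ∈ A)`, the law of the environment seen from the particle at time `n`. -/
def envLaw {d : ℕ} (P : Measure (Env d)) (n : ℕ) : Measure (Env d) :=
  (annealedLaw P 0).map (seenEnv n)

/-- The law on `Ω^ℕ` of the Markov process with kernel `π̂` and initial distribution `Q`. -/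
def envChainLaw {d : ℕ} (Q : Measure (Env d)) : Measure (ℕ → Env d) :=
  Q.bind (markovLaw (envKernel d))

/-- The Markov process with kernel `π̂` and initial distribution `Q` is ergodic: the time shift on
`Ω^ℕ` preserves the law of the process and all its shift-invariant events are trivial. -/
def ErgodicEnvChain {d : ℕ} (Q : Measure (Env d)) : Prop :=
  Ergodic (fun (w : ℕ → Env d) (n : ℕ) => w (n + 1)) (envChainLaw Q)

/-! ### Assumptions on the environment -/

/-- `P` is an i.i.d. product measure over the sites. -/
def IsIIDEnvironment {d : ℕ} (P : Measure (Env d)) : Prop :=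
  ∃ ν : Measure (PMF (Site d)), IsProbabilityMeasure ν ∧
    P = Measure.infinitePi (fun _ : Site d => ν)

/-- The scalar product `x · u` of a site with a vector of `ℝ^d`. -/
def dot {d : ℕ} (x : Site d) (u : Fin d → ℝ) : ℝ := ∑ i, (x i : ℝ) * u i

/-- The `l¹`-norm of a site. -/
def l1norm {d : ℕ} (x : Site d) : ℝ := ∑ i, |(x i : ℝ)|

/-- `-u` is a forbidden direction: `P(∑_{z · u ≥ 0} π_{0z} = 1) = 1`. -/
def ForbiddenDirection {d : ℕ} (P : Measure (Env d)) (u : Fin d → ℝ) : Prop :=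
  ∀ᵐ ω ∂P, ∑' z : {z : Site d // 0 ≤ dot z u}, jump ω 0 z = 1

/-- Hypothesis (N): `∑_z (z · u) π_{0z} ≥ δ` almost surely, for some constant `δ > 0`.
As `δ > 0`, the inequality fails where the series is not summable (its value is then `0`). -/
def NonNestling {d : ℕ} (P : Measure (Env d)) (u : Fin d → ℝ) : Prop :=
  ∃ δ : ℝ, 0 < δ ∧ ∀ᵐ ω ∂P, δ ≤ ∑' z : Site d, dot z u * (jump ω 0 z).toReal

/-- Hypothesis (M) with exponent `p`: `∑_z |z|^p π_{0z} ≤ M^p` almost surely, for some constant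
`M > 0`. -/
def MomentBound {d : ℕ} (P : Measure (Env d)) (p : ℝ) : Prop :=
  ∃ M : ℝ, 0 < M ∧
    ∀ᵐ ω ∂P, ∑' z : Site d, ENNReal.ofReal (l1norm z ^ p) * jump ω 0 z ≤ ENNReal.ofReal (M ^ p)

/-! ### Half-space σ-algebras -/

/-- `𝔖_k = σ(ω_x : x · u ≥ k)`. -/
@[reducible] def halfSpace {d : ℕ} (u : Fin d → ℝ) (k : ℤ) : MeasurableSpace (Env d) :=
  ⨆ x : {x : Site d // (k : ℝ) ≤ dot x u},
    MeasurableSpace.comap (fun ω : Env d => ω x) instMeasurableSpacePMF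

lemma halfSpace_le {d : ℕ} (u : Fin d → ℝ) (k : ℤ) :
    halfSpace u k ≤ (MeasurableSpace.pi : MeasurableSpace (Env d)) :=
  iSup_le fun x => (measurable_pi_apply x.1).comap_le

/-- `μ` is absolutely continuous with respect to `ν` on the σ-algebra `m`. -/
def AbsContOn {Ω : Type*} {mΩ : MeasurableSpace Ω} (m : MeasurableSpace Ω)
    (μ ν : @Measure Ω mΩ) : Prop :=
  ∀ A : Set Ω, MeasurableSet[m] A → ν A = 0 → μ A = 0

end

end RWRE

namespace RWRE

/-! ### Transfer operators of weighted shifts -/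

/-! The drift and moment conditions force almost every step law to give mass at least `ε` to jumps
advancing by at least `η` in direction `u`. Split each step law into a marked part of mass exactly
`ε`, made of such jumps, and an unmarked part of mass `1 - ε`, which never retreats. Since the mass
of the marked part does not depend on the environment, marking is an independent coin toss at each
step.

The walk never goes back, so it has read no site strictly ahead of its current position. A marked
step therefore places it in a half-space of sites that are still i.i.d. (`Fresh.lintegral_op`). Let
`K`, `R` be the transfer operators of unmarked and marked steps. Expanding `(K + R)^n` at the last
`R` expresses the law of the environment seen at time `n` on `{x · u ≥ 0}` by the geometric age of
the last marked step. Each further factor `R K^i` deepens the visible half-space by `η`, so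
induction on the depth gives limits on all half-spaces. Expanding at the first `R` instead removes
the dependence on a bounded amount of environment already revealed, and an `L¹` martingale
approximation reaches every initial law that is absolutely continuous on the half-space
(`tendsto_of_upperAbsCont`).

This one convergence, `∫ (K + R)^n f dμ → μ(Ω) ∫ f dQ`, carries the theorem. With `μ = P` it gives
convergence, invariance and absolute continuity. With `μ` another invariant law it gives uniqueness.
With `μ` the restriction of `Q` to an event it gives mixing, hence ergodicity. The measure `Q`
itself is assembled from the consistent half-space limits by an Ionescu-Tulcea construction
(`exists_measure_of_consistent`). -/

lemma dot_add {d : ℕ} (x y : Site d) (u : Fin d → ℝ) : dot (x + y) u = dot x u + dot y u := by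
  simp [dot, add_mul, Finset.sum_add_distrib]

@[simp] lemma dot_zero {d : ℕ} (u : Fin d → ℝ) : dot (0 : Site d) u = 0 := by
  simp [dot]

lemma measurable_shift_const {d : ℕ} (z : Site d) : Measurable (shift (d := d) z) :=
  measurable_pi_lambda _ fun x => measurable_pi_apply (x + z)

lemma shift_shift {d : ℕ} (y z : Site d) (ω : Env d) : shift y (shift z ω) = shift (z + y) ω := by
  funext x
  simp only [shift, add_assoc, add_comm y z]

lemma shift_zero {d : ℕ} (ω : Env d) : shift 0 ω = ω := by
  funext x
  simp [shift]

/-- The operator `f ↦ ∑_z w(ω_0, z) f(T_z ω)` attached to a weight `w`, as an additive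
endomorphism. -/
noncomputable def op {d : ℕ} (w : PMF (Site d) → Site d → ℝ≥0∞) :
    AddMonoid.End (Env d → ℝ≥0∞) where
  toFun f ω := ∑' z, w (ω 0) z * f (shift z ω)
  map_zero' := by ext ω; simp
  map_add' f g := by ext ω; simp [mul_add, ENNReal.tsum_add]

lemma op_apply {d : ℕ} (w : PMF (Site d) → Site d → ℝ≥0∞) (f : Env d → ℝ≥0∞) (ω : Env d) :
    op w f ω = ∑' z, w (ω 0) z * f (shift z ω) := rfl

/-- The adjoint action of `op w` on measures. -/
noncomputable def push {d : ℕ} (w : PMF (Site d) → Site d → ℝ≥0∞) (μ : Measure (Env d)) :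
    Measure (Env d) :=
  Measure.sum fun z => (μ.withDensity fun ω => w (ω 0) z).map (shift z)

lemma measurable_weight {d : ℕ} {w : PMF (Site d) → Site d → ℝ≥0∞}
    (hw : ∀ z, Measurable fun π => w π z) (z : Site d) :
    Measurable fun ω : Env d => w (ω 0) z :=
  (hw z).comp (measurable_pi_apply 0)

lemma measurable_op {d : ℕ} {w : PMF (Site d) → Site d → ℝ≥0∞}
    (hw : ∀ z, Measurable fun π => w π z) {f : Env d → ℝ≥0∞} (hf : Measurable f) :
    Measurable (op w f) :=
  Measurable.tsum fun z => (measurable_weight hw z).mul (hf.comp (measurable_shift_const z))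

lemma measurable_op_pow {d : ℕ} {w : PMF (Site d) → Site d → ℝ≥0∞}
    (hw : ∀ z, Measurable fun π => w π z) (n : ℕ) {f : Env d → ℝ≥0∞} (hf : Measurable f) :
    Measurable ((op w ^ n) f) := by
  induction n generalizing f with
  | zero => simpa using hf
  | succ n ih =>
    rw [pow_succ]
    exact ih (measurable_op hw hf)

lemma lintegral_push {d : ℕ} {w : PMF (Site d) → Site d → ℝ≥0∞}
    (hw : ∀ z, Measurable fun π => w π z) (μ : Measure (Env d)) {f : Env d → ℝ≥0∞}
    (hf : Measurable f) : ∫⁻ ω, f ω ∂(push w μ) = ∫⁻ ω, op w f ω ∂μ := by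
  simp only [push, op_apply]
  rw [lintegral_sum_measure, lintegral_tsum]
  · refine tsum_congr fun z => ?_
    rw [lintegral_map hf (measurable_shift_const z)]
    exact lintegral_withDensity_eq_lintegral_mul _ (measurable_weight hw z)
      (hf.comp (measurable_shift_const z))
  · exact fun z =>
      ((measurable_weight hw z).mul (hf.comp (measurable_shift_const z))).aemeasurable

lemma lintegral_push_iterate {d : ℕ} {w : PMF (Site d) → Site d → ℝ≥0∞}
    (hw : ∀ z, Measurable fun π => w π z) (μ : Measure (Env d)) (n : ℕ) {f : Env d → ℝ≥0∞}
    (hf : Measurable f) : ∫⁻ ω, f ω ∂((push w)^[n] μ) = ∫⁻ ω, (op w ^ n) f ω ∂μ := by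
  induction n generalizing f with
  | zero => simp
  | succ n ih =>
    rw [Function.iterate_succ_apply', lintegral_push hw _ hf, ih (measurable_op hw hf), pow_succ]
    rfl

lemma op_mono {d : ℕ} (w : PMF (Site d) → Site d → ℝ≥0∞) {f g : Env d → ℝ≥0∞}
    (h : ∀ ω, f ω ≤ g ω) (ω : Env d) : op w f ω ≤ op w g ω :=
  ENNReal.tsum_le_tsum fun _ => mul_le_mul_right (h _) _

lemma op_const {d : ℕ} {w : PMF (Site d) → Site d → ℝ≥0∞} {e : ℝ≥0∞}
    (he : ∀ π, ∑' z, w π z = e) (c : ℝ≥0∞) (ω : Env d) : op w (fun _ => c) ω = e * c := by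
  rw [op_apply, ENNReal.tsum_mul_right, he]

lemma op_le {d : ℕ} {w : PMF (Site d) → Site d → ℝ≥0∞} {e : ℝ≥0∞}
    (he : ∀ π, ∑' z, w π z = e) {f : Env d → ℝ≥0∞} {c : ℝ≥0∞} (hf : ∀ ω, f ω ≤ c) (ω : Env d) :
    op w f ω ≤ e * c :=
  (op_mono w hf ω).trans_eq (op_const he c ω)

lemma op_pow_const {d : ℕ} {w : PMF (Site d) → Site d → ℝ≥0∞} {e : ℝ≥0∞}
    (he : ∀ π, ∑' z, w π z = e) (n : ℕ) (c : ℝ≥0∞) (ω : Env d) :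
    (op w ^ n) (fun _ => c) ω = e ^ n * c := by
  induction n generalizing c with
  | zero => simp
  | succ n ih =>
    rw [pow_succ, pow_succ]
    change (op w ^ n) (op w fun _ => c) ω = _
    rw [show op w (fun _ => c) = fun _ => e * c from funext (op_const he c), ih, mul_assoc]

lemma op_pow_le {d : ℕ} {w : PMF (Site d) → Site d → ℝ≥0∞} {e : ℝ≥0∞}
    (he : ∀ π, ∑' z, w π z = e) (n : ℕ) {f : Env d → ℝ≥0∞} {c : ℝ≥0∞} (hf : ∀ ω, f ω ≤ c)
    (ω : Env d) : (op w ^ n) f ω ≤ e ^ n * c := by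
  induction n generalizing f c with
  | zero => simpa using hf ω
  | succ n ih =>
    rw [pow_succ, pow_succ, mul_assoc]
    exact ih (op_le he hf)

lemma op_add_weight {d : ℕ} (v w : PMF (Site d) → Site d → ℝ≥0∞) : op (v + w) = op v + op w := by
  refine AddMonoidHom.ext fun f => funext fun ω => ?_
  change ∑' z, (v (ω 0) z + w (ω 0) z) * f (shift z ω) = op v f ω + op w f ω
  simp only [add_mul, ENNReal.tsum_add, op_apply]

/-- The weight reads the site `0`, which accounts for the minimum with `0`. The shifted function
reads the sites `x + z`, raised by at least `h`. -/
lemma dependsOn_op {d : ℕ} {u : Fin d → ℝ} {h a : ℝ} {w : PMF (Site d) → Site d → ℝ≥0∞}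
    (hw : ∀ π z, w π z ≠ 0 → h ≤ dot z u) {f : Env d → ℝ≥0∞}
    (hf : DependsOn f {x | a ≤ dot x u}) :
    DependsOn (op w f) {x | min 0 (a + h) ≤ dot x u} := by
  intro ω ω' H
  have h0 : ω 0 = ω' 0 := H 0 (by simp)
  rw [op_apply, op_apply, h0]
  refine tsum_congr fun z => ?_
  by_cases hz : w (ω' 0) z = 0
  · simp [hz]
  · congr 1
    refine hf fun x hx => H _ ?_
    have := hw _ _ hz
    simp only [Set.mem_ofPred_eq, dot_add] at hx ⊢
    exact (min_le_right _ _).trans (by linarith)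

lemma dependsOn_of_le_level {d : ℕ} {β : Type*} {u : Fin d → ℝ} {a b : ℝ} (hab : a ≤ b)
    {f : Env d → β} (hf : DependsOn f {x | b ≤ dot x u}) : DependsOn f {x | a ≤ dot x u} :=
  fun _ _ H => hf fun x hx => H x (hab.trans hx)

lemma dependsOn_op_pow {d : ℕ} {u : Fin d → ℝ} {a : ℝ} (ha : a ≤ 0)
    {w : PMF (Site d) → Site d → ℝ≥0∞}
    (hw : ∀ π z, w π z ≠ 0 → 0 ≤ dot z u) (n : ℕ) {f : Env d → ℝ≥0∞}
    (hf : DependsOn f {x | a ≤ dot x u}) :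
    DependsOn ((op w ^ n) f) {x | a ≤ dot x u} := by
  induction n generalizing f with
  | zero => simpa using hf
  | succ n ih =>
    rw [pow_succ]
    exact ih (dependsOn_of_le_level (by simp [ha]) (dependsOn_op hw hf))

/-! ### ### Expansion of noncommutative words -/

lemma end_sum_apply {α β : Type*} [AddCommMonoid β] (s : Finset ℕ)
    (A : ℕ → AddMonoid.End (α → β)) (f : α → β) (a : α) :
    (∑ i ∈ s, A i) f a = ∑ i ∈ s, A i f a := by
  classical
  induction s using Finset.induction_on with
  | empty => rfl
  | insert i s hi ih =>
    rw [Finset.sum_insert hi, Finset.sum_insert hi, ← ih]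
    rfl

/-- Decomposition of a word in `K + R` at its last factor `R`. -/
lemma add_pow_eq_sum_last {S : Type*} [Semiring S] (K R : S) (n : ℕ) :
    (K + R) ^ n = K ^ n + ∑ i ∈ Finset.range n, (K + R) ^ (n - 1 - i) * (R * K ^ i) := by
  induction n with
  | zero => simp
  | succ n ih =>
    rw [pow_succ, mul_add, Finset.sum_range_succ']
    nth_rewrite 1 [ih]
    rw [add_mul, ← pow_succ, Finset.sum_mul, add_assoc]
    congr 1
    simp only [Nat.sub_zero, pow_zero, mul_one, Nat.add_sub_cancel]
    congr 1
    refine Finset.sum_congr rfl fun i _ => ?_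
    rw [pow_succ, mul_assoc, mul_assoc, show n - (i + 1) = n - 1 - i by omega]

/-- Decomposition of a word in `K + R` at its first factor `R`. -/
lemma add_pow_eq_sum_first {S : Type*} [Semiring S] (K R : S) (n : ℕ) :
    (K + R) ^ n = K ^ n + ∑ i ∈ Finset.range n, K ^ i * R * (K + R) ^ (n - 1 - i) := by
  induction n with
  | zero => simp
  | succ n ih =>
    rw [pow_succ', add_mul, Finset.sum_range_succ']
    nth_rewrite 1 [ih]
    rw [mul_add, ← pow_succ', Finset.mul_sum, add_assoc]
    congr 1
    simp only [Nat.sub_zero, pow_zero, one_mul, Nat.add_sub_cancel]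
    congr 1
    refine Finset.sum_congr rfl fun i _ => ?_
    rw [pow_succ', ← mul_assoc, ← mul_assoc, show n - (i + 1) = n - 1 - i by omega]

/-! ### Dominated convergence for convolution-type sums -/

lemma tendsto_tsum_of_dominated {F : ℕ → ℕ → ℝ≥0∞} {G B : ℕ → ℝ≥0∞}
    (hB : ∑' i, B i ≠ ∞) (hF : ∀ n i, F n i ≤ B i)
    (hG : ∀ i, Tendsto (fun n => F n i) atTop (𝓝 (G i))) :
    Tendsto (fun n => ∑' i, F n i) atTop (𝓝 (∑' i, G i)) := by
  simp only [← lintegral_count] at hB ⊢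
  exact tendsto_lintegral_of_dominated_convergence B (fun n => Measurable.of_discrete)
    (fun n => Eventually.of_forall (hF n)) hB (Eventually.of_forall hG)

/-- Dominated convergence in `i`, the terms with `i ≥ n` being set to zero. In the applications `i`
is the age of the last marked step or the waiting time before the first one, and `r` is the
contribution of paths without marked steps. -/
lemma tendsto_convolution {x r : ℕ → ℝ≥0∞} {y : ℕ → ℕ → ℝ≥0∞} {B ℓ : ℕ → ℝ≥0∞}
    (hx : ∀ n, x n = r n + ∑ i ∈ Finset.range n, y i (n - 1 - i))
    (hr : Tendsto r atTop (𝓝 0)) (hB : ∑' i, B i ≠ ∞) (hy : ∀ i m, y i m ≤ B i)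
    (hℓ : ∀ i, Tendsto (y i) atTop (𝓝 (ℓ i))) :
    Tendsto x atTop (𝓝 (∑' i, ℓ i)) := by
  have key : Tendsto (fun n => ∑' i, if i < n then y i (n - 1 - i) else 0) atTop
      (𝓝 (∑' i, ℓ i)) := by
    refine tendsto_tsum_of_dominated hB (fun n i => ?_) fun i => ?_
    · split_ifs
      · exact hy _ _
      · exact zero_le
    · have h1 : Tendsto (fun n => y i (n - 1 - i)) atTop (𝓝 (ℓ i)) :=
        (hℓ i).comp ((tendsto_sub_atTop_nat i).comp (tendsto_sub_atTop_nat 1))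
      refine h1.congr' ?_
      filter_upwards [eventually_gt_atTop i] with n hn
      rw [if_pos hn]
  have := hr.add key
  rw [zero_add] at this
  refine this.congr fun n => ?_
  rw [hx n, tsum_eq_sum (s := Finset.range n)]
  · congr 1
    exact Finset.sum_congr rfl fun i hi => if_pos (Finset.mem_range.1 hi)
  · intro i hi
    exact if_neg (by simpa using hi)

/-! ### Product environments: stationarity and resampling of a half-space -/

lemma IsIIDEnvironment.map_shift {d : ℕ} {P : Measure (Env d)} (hP : IsIIDEnvironment P)
    (z : Site d) : P.map (shift z) = P := by
  obtain ⟨ν, hν, rfl⟩ := hP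
  have h := Measure.infinitePi_map_piCongrLeft (X := fun _ : Site d => PMF (Site d))
    (fun _ => ν) (Equiv.addRight (-z))
  convert h using 2
  funext ω x
  obtain ⟨y, rfl⟩ := (Equiv.addRight (-z)).surjective x
  rw [MeasurableEquiv.coe_piCongrLeft, Equiv.piCongrLeft_apply_apply]
  simp [shift]

lemma IsIIDEnvironment.lintegral_shift {d : ℕ} {P : Measure (Env d)} (hP : IsIIDEnvironment P)
    (z : Site d) {f : Env d → ℝ≥0∞} (hf : Measurable f) :
    ∫⁻ ω, f (shift z ω) ∂P = ∫⁻ ω, f ω ∂P := by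
  conv_rhs => rw [← hP.map_shift z]
  rw [lintegral_map hf (measurable_shift_const z)]

/-- The environment equal to `ω` on `{x · u ≤ b}` and to `ω'` on `{x · u > b}`. -/
noncomputable def glue {d : ℕ} (u : Fin d → ℝ) (b : ℝ) (ω ω' : Env d) : Env d :=
  open Classical in fun x => if dot x u ≤ b then ω x else ω' x

lemma glue_of_le {d : ℕ} {u : Fin d → ℝ} {b : ℝ} {x : Site d} (h : dot x u ≤ b) (ω ω' : Env d) :
    glue u b ω ω' x = ω x := if_pos h

lemma glue_of_lt {d : ℕ} {u : Fin d → ℝ} {b : ℝ} {x : Site d} (h : b < dot x u) (ω ω' : Env d) :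
    glue u b ω ω' x = ω' x := if_neg (not_le.2 h)

lemma measurable_glue {d : ℕ} (u : Fin d → ℝ) (b : ℝ) :
    Measurable fun q : Env d × Env d => glue u b q.1 q.2 := by
  refine measurable_pi_lambda _ fun x => ?_
  by_cases h : dot x u ≤ b
  · simp only [glue_of_le h]
    exact (measurable_pi_apply x).comp measurable_fst
  · simp only [glue_of_lt (not_le.1 h)]
    exact (measurable_pi_apply x).comp measurable_snd

lemma glue_glue {d : ℕ} (u : Fin d → ℝ) {b c : ℝ} (hbc : b ≤ c) (ω ω' ω'' : Env d) :
    glue u c (glue u b ω ω') ω'' = glue u b ω (glue u c ω' ω'') := by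
  funext x
  rcases le_or_gt (dot x u) b with h | h
  · rw [glue_of_le (h.trans hbc), glue_of_le h, glue_of_le h]
  · rw [glue_of_lt h]
    rcases le_or_gt (dot x u) c with h' | h'
    · rw [glue_of_le h', glue_of_le h', glue_of_lt h]
    · rw [glue_of_lt h', glue_of_lt h']

lemma shift_glue {d : ℕ} (u : Fin d → ℝ) (b : ℝ) (z : Site d) (ω ω' : Env d) :
    shift z (glue u (b + dot z u) ω ω') = glue u b (shift z ω) (shift z ω') := by
  funext x
  change glue u (b + dot z u) ω ω' (x + z) = _
  rcases le_or_gt (dot x u) b with h | h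
  · rw [glue_of_le (by rw [dot_add]; linarith), glue_of_le h]
    rfl
  · rw [glue_of_lt (by rw [dot_add]; linarith), glue_of_lt h]
    rfl

/-- A product measure is determined by finite boxes, and the preimage of a box under gluing is the
product of its sides below the level and its sides above. -/
lemma IsIIDEnvironment.map_glue {d : ℕ} {P : Measure (Env d)} [IsProbabilityMeasure P]
    (hP : IsIIDEnvironment P)
    (u : Fin d → ℝ) (b : ℝ) : (P.prod P).map (fun q => glue u b q.1 q.2) = P := by
  classical
  obtain ⟨ν, hν, rfl⟩ := hP
  refine Measure.eq_infinitePi _ fun s t ht => ?_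
  rw [Measure.map_apply (measurable_glue u b) (.pi s.countable_toSet fun _ _ => ht _)]
  have : (fun q : Env d × Env d => glue u b q.1 q.2) ⁻¹' (s : Set (Site d)).pi t =
      (((s.filter fun x => dot x u ≤ b : Finset (Site d)) : Set (Site d)).pi t) ×ˢ
      (((s.filter fun x => ¬ dot x u ≤ b : Finset (Site d)) : Set (Site d)).pi t) := by
    ext q
    simp only [Set.mem_preimage, Set.mem_pi, Set.mem_prod, Finset.mem_coe, Finset.mem_filter]
    constructor
    · intro h
      exact ⟨fun x hx => by simpa [glue_of_le hx.2] using h x hx.1,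
        fun x hx => by simpa [glue_of_lt (not_le.1 hx.2)] using h x hx.1⟩
    · intro h x hx
      by_cases hb : dot x u ≤ b
      · simpa [glue_of_le hb] using h.1 x ⟨hx, hb⟩
      · simpa [glue_of_lt (not_le.1 hb)] using h.2 x ⟨hx, hb⟩
  rw [this, Measure.prod_prod, Measure.infinitePi_pi _ fun _ _ => ht _,
    Measure.infinitePi_pi _ fun _ _ => ht _, Finset.prod_filter_mul_prod_filter_not]

/-- Under `μ`, the environment on `{x · u > b}` is distributed as under `P` and independent of the
environment on `{x · u ≤ b}`. -/
def Fresh {d : ℕ} (P : Measure (Env d)) (u : Fin d → ℝ) (b : ℝ) (μ : Measure (Env d)) : Prop :=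
  ∀ F : Env d → ℝ≥0∞, Measurable F →
    ∫⁻ ω, F ω ∂μ = ∫⁻ ω, ∫⁻ ω', F (glue u b ω ω') ∂P ∂μ

section Fresh

variable {d : ℕ} {P : Measure (Env d)} [IsProbabilityMeasure P] {u : Fin d → ℝ}

lemma measurable_lintegral_glue (P : Measure (Env d)) [IsProbabilityMeasure P]
    (u : Fin d → ℝ) (b : ℝ) {F : Env d → ℝ≥0∞}
    (hF : Measurable F) : Measurable fun ω => ∫⁻ ω', F (glue u b ω ω') ∂P :=
  Measurable.lintegral_prod_right' (f := fun q : Env d × Env d => F (glue u b q.1 q.2))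
    (hF.comp (measurable_glue u b))

lemma measurable_glue_right (u : Fin d → ℝ) (b : ℝ) (ω : Env d) :
    Measurable fun ω' : Env d => glue u b ω ω' :=
  (measurable_glue u b).comp measurable_prodMk_left

lemma IsIIDEnvironment.fresh (hP : IsIIDEnvironment P) (b : ℝ) : Fresh P u b P := by
  intro F hF
  conv_lhs => rw [← hP.map_glue u b]
  rw [lintegral_map hF (measurable_glue u b)]
  exact lintegral_prod _ (hF.comp (measurable_glue u b)).aemeasurable

/-- Resampling beyond `c` after resampling beyond `b` only replaces one sample of `P` by another,
because `P` is itself fresh beyond `c`. -/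
lemma Fresh.mono (hP : IsIIDEnvironment P) {b c : ℝ} (hbc : b ≤ c) {μ : Measure (Env d)}
    (h : Fresh P u b μ) : Fresh P u c μ := by
  intro F hF
  rw [h F hF, h _ (measurable_lintegral_glue P u c hF)]
  refine lintegral_congr fun ω => ?_
  simp only [glue_glue u hbc]
  exact hP.fresh (u := u) c _ (hF.comp (measurable_glue_right u b ω))

/-- Seen from the new position, the frontier of revealed sites recedes by at least `h`. It is kept
nonnegative so that the site `0`, which the next weight reads, stays on the revealed side and the
lemma can be iterated. -/
lemma Fresh.push (hP : IsIIDEnvironment P) {b h : ℝ} (hb : 0 ≤ b)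
    {w : PMF (Site d) → Site d → ℝ≥0∞} (hw : ∀ z, Measurable fun π => w π z)
    (hsupp : ∀ π z, w π z ≠ 0 → h ≤ dot z u) {μ : Measure (Env d)}
    (hμ : Fresh P u b μ) : Fresh P u (max 0 (b - h)) (push w μ) := by
  intro F hF
  rw [lintegral_push hw μ hF, lintegral_push hw μ (measurable_lintegral_glue P u _ hF)]
  simp only [op_apply]
  have hm : ∀ {G : Env d → ℝ≥0∞}, Measurable G → ∀ z,
      Measurable fun ω : Env d => w (ω 0) z * G (shift z ω) := fun hG z =>
    (measurable_weight hw z).mul (hG.comp (measurable_shift_const z))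
  rw [lintegral_tsum fun z => (hm hF z).aemeasurable,
    lintegral_tsum fun z => (hm (measurable_lintegral_glue P u _ hF) z).aemeasurable]
  refine tsum_congr fun z => ?_
  by_cases hz : h ≤ dot z u
  · have hc : b ≤ max 0 (b - h) + dot z u := by linarith [le_max_right 0 (b - h)]
    rw [hμ.mono hP hc _ (hm hF z)]
    refine lintegral_congr fun ω => ?_
    have h0 : dot (0 : Site d) u ≤ max 0 (b - h) + dot z u := by
      rw [dot_zero]; exact hb.trans hc
    simp only [glue_of_le h0, shift_glue]
    have hF' : Measurable fun ω' => F (glue u (max 0 (b - h)) (shift z ω) ω') :=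
      hF.comp (measurable_glue_right _ _ _)
    refine (lintegral_const_mul _ (hF'.comp (measurable_shift_const z))).trans ?_
    exact congrArg _ (hP.lintegral_shift z hF')
  · have : ∀ π, w π z = 0 := fun π => by_contra fun hne => hz (hsupp π z hne)
    simp [this]

end Fresh

/-- The renewal property. An advance by `h > 0` from a frontier at level `0` carries the whole
half-space `{x · u ≥ 0}` strictly beyond the frontier. There `f` is independent of the weight and,
by stationarity, integrates as under `P`. -/
lemma Fresh.lintegral_op {d : ℕ} {P : Measure (Env d)} {u : Fin d → ℝ} (hP : IsIIDEnvironment P)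
    {h : ℝ} (hh : 0 < h)
    {w : PMF (Site d) → Site d → ℝ≥0∞} (hw : ∀ z, Measurable fun π => w π z)
    (hsupp : ∀ π z, w π z ≠ 0 → h ≤ dot z u) {e : ℝ≥0∞} (he : ∀ π, ∑' z, w π z = e)
    {μ : Measure (Env d)} (hμ : Fresh P u 0 μ) {f : Env d → ℝ≥0∞} (hf : Measurable f)
    (hdep : DependsOn f {x | 0 ≤ dot x u}) :
    ∫⁻ ω, op w f ω ∂μ = e * μ Set.univ * ∫⁻ ω, f ω ∂P := by
  have hm : ∀ z, Measurable fun ω : Env d => w (ω 0) z * f (shift z ω) := fun z =>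
    (measurable_weight hw z).mul (hf.comp (measurable_shift_const z))
  have key : ∀ z, ∫⁻ ω, w (ω 0) z * f (shift z ω) ∂μ =
      (∫⁻ ω, w (ω 0) z ∂μ) * ∫⁻ ω, f ω ∂P := by
    intro z
    by_cases hz : h ≤ dot z u
    · rw [hμ _ (hm z), ← lintegral_mul_const _ (measurable_weight hw z)]
      refine lintegral_congr fun ω => ?_
      have hs : ∀ ω', f (shift z (glue u 0 ω ω')) = f (shift z ω') := fun ω' =>
        hdep fun x (hx : 0 ≤ dot x u) => glue_of_lt (by rw [dot_add]; linarith) _ _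
      simp only [glue_of_le (dot_zero u).le, hs]
      refine (lintegral_const_mul _ (hf.comp (measurable_shift_const z))).trans ?_
      exact congrArg _ (hP.lintegral_shift z hf)
    · have : ∀ π, w π z = 0 := fun π => by_contra fun hne => hz (hsupp π z hne)
      simp [this]
  simp only [op_apply]
  rw [lintegral_tsum fun z => (hm z).aemeasurable]
  simp only [key]
  rw [ENNReal.tsum_mul_right, ← lintegral_tsum fun z => (measurable_weight hw z).aemeasurable]
  simp [he]

/-! ### Splitting off steps of a fixed mass in a fixed direction -/

/-- A splitting of step laws into an unmarked part, which does not move against `u`, and a marked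
part of mass `ε`, which advances by at least `η` in direction `u`. -/
structure Splitting {d : ℕ} (u : Fin d → ℝ) (η : ℝ) (ε : ℝ≥0∞) where
  /-- The unmarked part. -/
  unm : PMF (Site d) → Site d → ℝ≥0∞
  /-- The marked part. -/
  mrk : PMF (Site d) → Site d → ℝ≥0∞
  measurable_unm : ∀ z, Measurable fun π => unm π z
  measurable_mrk : ∀ z, Measurable fun π => mrk π z
  le_of_unm_ne_zero : ∀ π z, unm π z ≠ 0 → 0 ≤ dot z u
  le_of_mrk_ne_zero : ∀ π z, mrk π z ≠ 0 → η ≤ dot z u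
  tsum_unm : ∀ π, ∑' z, unm π z = 1 - ε
  tsum_mrk : ∀ π, ∑' z, mrk π z = ε
  pos_η : 0 < η
  pos_ε : 0 < ε
  ε_le_one : ε ≤ 1

namespace Splitting

variable {d : ℕ} {u : Fin d → ℝ} {η : ℝ} {ε : ℝ≥0∞} (S : Splitting u η ε)

/-- The full step weight. -/
noncomputable def full : PMF (Site d) → Site d → ℝ≥0∞ := S.unm + S.mrk

lemma measurable_full (z : Site d) : Measurable fun π => S.full π z :=
  (S.measurable_unm z).add (S.measurable_mrk z)

lemma le_of_full_ne_zero (π : PMF (Site d)) (z : Site d) (h : S.full π z ≠ 0) : 0 ≤ dot z u := by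
  by_cases h' : S.unm π z = 0
  · refine S.pos_η.le.trans (S.le_of_mrk_ne_zero π z fun h'' => h ?_)
    simp [full, h', h'']
  · exact S.le_of_unm_ne_zero π z h'

lemma tsum_full (π : PMF (Site d)) : ∑' z, S.full π z = 1 := by
  have : ∑' z, S.full π z = ∑' z, S.unm π z + ∑' z, S.mrk π z := ENNReal.tsum_add
  rw [this, S.tsum_unm, S.tsum_mrk, tsub_add_cancel_of_le S.ε_le_one]

lemma op_full : op S.full = op S.unm + op S.mrk := op_add_weight _ _

lemma op_full_pow_le_one (n : ℕ) {f : Env d → ℝ≥0∞} (hf : ∀ ω, f ω ≤ 1) (ω : Env d) :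
    (op S.full ^ n) f ω ≤ 1 := by
  simpa using op_pow_le S.tsum_full n hf ω

/-- The mass of the first marked steps. -/
lemma tsum_geometric (S : Splitting u η ε) : ∑' i : ℕ, ε * (1 - ε) ^ i = 1 := by
  rw [ENNReal.tsum_mul_left, ENNReal.tsum_geometric,
    ENNReal.sub_sub_cancel ENNReal.one_ne_top S.ε_le_one]
  exact ENNReal.mul_inv_cancel S.pos_ε.ne' (ne_top_of_le_ne_top ENNReal.one_ne_top S.ε_le_one)

lemma one_sub_lt_one (S : Splitting u η ε) : 1 - ε < 1 :=
  ENNReal.sub_lt_self ENNReal.one_ne_top one_ne_zero S.pos_ε.ne'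

lemma tendsto_pow (S : Splitting u η ε) (c : ℝ≥0∞) (hc : c ≠ ∞) :
    Tendsto (fun n => (1 - ε) ^ n * c) atTop (𝓝 0) := by
  simpa using ENNReal.Tendsto.mul_const
    (ENNReal.tendsto_pow_atTop_nhds_zero_of_lt_one S.one_sub_lt_one) (Or.inr hc)

/-- `∫ K^n f dμ → 0`. -/
lemma tendsto_unm_pow (S : Splitting u η ε) (μ : Measure (Env d)) [IsFiniteMeasure μ]
    {f : Env d → ℝ≥0∞} (hf : ∀ ω, f ω ≤ 1) :
    Tendsto (fun n => ∫⁻ ω, (op S.unm ^ n) f ω ∂μ) atTop (𝓝 0) := by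
  refine tendsto_of_tendsto_of_tendsto_of_le_of_le tendsto_const_nhds
    (S.tendsto_pow (μ Set.univ) (measure_ne_top _ _)) (fun n => zero_le) fun n => ?_
  calc ∫⁻ ω, (op S.unm ^ n) f ω ∂μ ≤ ∫⁻ _, (1 - ε) ^ n ∂μ :=
        lintegral_mono fun ω => by simpa using op_pow_le S.tsum_unm n hf ω
    _ = (1 - ε) ^ n * μ Set.univ := by simp

/-- Convergence from the decomposition at the last marked step. -/
lemma tendsto_of_last (μ : Measure (Env d)) [IsFiniteMeasure μ] {f : Env d → ℝ≥0∞}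
    (hf : ∀ ω, f ω ≤ 1) (hfm : Measurable f) {ℓ : ℕ → ℝ≥0∞}
    (h : ∀ i, Tendsto (fun n => ∫⁻ ω, (op S.full ^ n) (op S.mrk ((op S.unm ^ i) f)) ω ∂μ) atTop
      (𝓝 (ℓ i))) :
    Tendsto (fun n => ∫⁻ ω, (op S.full ^ n) f ω ∂μ) atTop (𝓝 (∑' i, ℓ i)) := by
  have hm : ∀ i m, Measurable ((op S.full ^ m) (op S.mrk ((op S.unm ^ i) f))) := fun i m =>
    measurable_op_pow S.measurable_full _
      (measurable_op S.measurable_mrk (measurable_op_pow S.measurable_unm _ hfm))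
  -- The bound is uniform in `m` because full steps preserve total mass, while `R K^i` has mass `ε
  -- (1 - ε)^i`.
  refine tendsto_convolution (B := fun i => ε * (1 - ε) ^ i * μ Set.univ) (fun n => ?_)
    (S.tendsto_unm_pow μ hf) ?_ (fun i m => ?_) h
  · rw [← lintegral_finsetSum _ fun i _ => hm i _,
      ← lintegral_add_left (measurable_op_pow S.measurable_unm _ hfm)]
    refine lintegral_congr fun ω => ?_
    conv_lhs => rw [S.op_full, add_pow_eq_sum_last, ← S.op_full]
    exact congrArg ((op S.unm ^ n) f ω + ·) (end_sum_apply _ _ f ω)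
  · rw [ENNReal.tsum_mul_right, S.tsum_geometric, one_mul]
    exact measure_ne_top _ _
  · calc ∫⁻ ω, (op S.full ^ m) (op S.mrk ((op S.unm ^ i) f)) ω ∂μ
        ≤ ∫⁻ _, ε * (1 - ε) ^ i ∂μ := lintegral_mono fun ω => by
          simpa using op_pow_le S.tsum_full m
            (op_le S.tsum_mrk (op_pow_le S.tsum_unm i hf)) ω
      _ = _ := by simp

/-- Convergence from the decomposition at the first marked step. -/
lemma tendsto_of_first (μ : Measure (Env d)) [IsFiniteMeasure μ] {f : Env d → ℝ≥0∞}
    (hf : ∀ ω, f ω ≤ 1) (hfm : Measurable f) {ℓ : ℕ → ℝ≥0∞}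
    (h : ∀ i, Tendsto (fun n => ∫⁻ ω, (op S.full ^ n) f ω ∂(push S.mrk ((push S.unm)^[i] μ))) atTop
      (𝓝 (ℓ i))) :
    Tendsto (fun n => ∫⁻ ω, (op S.full ^ n) f ω ∂μ) atTop (𝓝 (∑' i, ℓ i)) := by
  have hm : ∀ m, Measurable ((op S.full ^ m) f) := fun m =>
    measurable_op_pow S.measurable_full _ hfm
  have hpush : ∀ i m, ∫⁻ ω, (op S.full ^ m) f ω ∂(push S.mrk ((push S.unm)^[i] μ)) =
      ∫⁻ ω, (op S.unm ^ i) (op S.mrk ((op S.full ^ m) f)) ω ∂μ := fun i m => by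
    rw [lintegral_push S.measurable_mrk _ (hm m), lintegral_push_iterate S.measurable_unm _ _
      (measurable_op S.measurable_mrk (hm m))]
  simp only [hpush] at h
  refine tendsto_convolution (B := fun i => ε * (1 - ε) ^ i * μ Set.univ) (fun n => ?_)
    (S.tendsto_unm_pow μ hf) ?_ (fun i m => ?_) h
  · rw [← lintegral_finsetSum _ fun i _ => measurable_op_pow S.measurable_unm _
        (measurable_op S.measurable_mrk (hm _)),
      ← lintegral_add_left (measurable_op_pow S.measurable_unm _ hfm)]
    refine lintegral_congr fun ω => ?_
    conv_lhs => rw [S.op_full, add_pow_eq_sum_first, ← S.op_full]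
    exact congrArg ((op S.unm ^ n) f ω + ·) (end_sum_apply _ _ f ω)
  · rw [ENNReal.tsum_mul_right, S.tsum_geometric, one_mul]
    exact measure_ne_top _ _
  · calc ∫⁻ ω, (op S.unm ^ i) (op S.mrk ((op S.full ^ m) f)) ω ∂μ
        ≤ ∫⁻ _, ε * (1 - ε) ^ i ∂μ := lintegral_mono fun ω => by
          rw [mul_comm]
          simpa using op_pow_le S.tsum_unm i (op_le S.tsum_mrk (S.op_full_pow_le_one m hf)) ω
      _ = _ := by simp

/-! ### The limit law on half-spaces -/

/-- The sum over the ages of the current marked step. -/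
noncomputable def renew (μ : Measure (Env d)) : Measure (Env d) :=
  Measure.sum fun i => (push S.unm)^[i] μ

/-- The limit law on the half-space `{x · u ≥ - N η}`. -/
noncomputable def limitLaw (P : Measure (Env d)) : ℕ → Measure (Env d)
  | 0 => S.renew (ε • P)
  | N + 1 => S.renew (push S.mrk (limitLaw P N))

lemma lintegral_renew (μ : Measure (Env d)) {f : Env d → ℝ≥0∞} (hf : Measurable f) :
    ∫⁻ ω, f ω ∂(S.renew μ) = ∑' i, ∫⁻ ω, (op S.unm ^ i) f ω ∂μ := by
  rw [renew, lintegral_sum_measure]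
  exact tsum_congr fun i => lintegral_push_iterate S.measurable_unm μ i hf

/-- In the limit a marked step occurred `i` steps ago with weight `ε (1 - ε)^i`, the power being the
mass left by `op S.unm ^ i`. Just after it, the half-space at level `0` had law `P`. -/
lemma lintegral_limitLaw_zero (P : Measure (Env d)) {f : Env d → ℝ≥0∞} (hf : Measurable f) :
    ∫⁻ ω, f ω ∂(S.limitLaw P 0) = ∑' i, ε * ∫⁻ ω, (op S.unm ^ i) f ω ∂P := by
  simp only [limitLaw, S.lintegral_renew _ hf, lintegral_smul_measure, smul_eq_mul]

lemma lintegral_limitLaw_succ (P : Measure (Env d)) (N : ℕ) {f : Env d → ℝ≥0∞}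
    (hf : Measurable f) :
    ∫⁻ ω, f ω ∂(S.limitLaw P (N + 1)) =
      ∑' i, ∫⁻ ω, op S.mrk ((op S.unm ^ i) f) ω ∂(S.limitLaw P N) := by
  simp only [limitLaw, S.lintegral_renew _ hf]
  exact tsum_congr fun i => lintegral_push S.measurable_mrk _ (measurable_op_pow S.measurable_unm i hf)

variable {P : Measure (Env d)} [IsProbabilityMeasure P]

lemma measure_push_mrk_univ (μ : Measure (Env d)) :
    push S.mrk μ Set.univ = ε * μ Set.univ := by
  rw [← lintegral_one, lintegral_push S.measurable_mrk _ measurable_const]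
  simp only [op_const S.tsum_mrk, lintegral_const, mul_one]

lemma measure_push_unm_iterate_univ (μ : Measure (Env d)) (i : ℕ) :
    (push S.unm)^[i] μ Set.univ = (1 - ε) ^ i * μ Set.univ := by
  rw [← lintegral_one, lintegral_push_iterate S.measurable_unm _ _ measurable_const]
  simp only [op_pow_const S.tsum_unm, lintegral_const, mul_one]

lemma measure_push_full_iterate_univ (μ : Measure (Env d)) (i : ℕ) :
    (push S.full)^[i] μ Set.univ = μ Set.univ := by
  rw [← lintegral_one, lintegral_push_iterate S.measurable_full _ _ measurable_const]
  simp [op_pow_const S.tsum_full, lintegral_const]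

lemma fresh_push_full_iterate (hP : IsIIDEnvironment P) {b : ℝ} (hb : 0 ≤ b) {μ : Measure (Env d)}
    (hμ : Fresh P u b μ) (n : ℕ) : Fresh P u b ((push S.full)^[n] μ) := by
  induction n with
  | zero => exact hμ
  | succ n ih =>
    rw [Function.iterate_succ_apply']
    have := ih.push hP hb S.measurable_full S.le_of_full_ne_zero
    rwa [sub_zero, max_eq_right hb] at this

lemma fresh_push_unm_iterate (hP : IsIIDEnvironment P) {b : ℝ} (hb : 0 ≤ b) {μ : Measure (Env d)}
    (hμ : Fresh P u b μ) (n : ℕ) : Fresh P u b ((push S.unm)^[n] μ) := by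
  induction n with
  | zero => exact hμ
  | succ n ih =>
    rw [Function.iterate_succ_apply']
    have := ih.push hP hb S.measurable_unm S.le_of_unm_ne_zero
    rwa [sub_zero, max_eq_right hb] at this

/-- Convergence to the limit law from a fresh initial law. -/
lemma tendsto_of_fresh_zero (hP : IsIIDEnvironment P) (N : ℕ) (μ : Measure (Env d))
    [IsFiniteMeasure μ] (hμ : Fresh P u 0 μ) {f : Env d → ℝ≥0∞} (hf : ∀ ω, f ω ≤ 1)
    (hfm : Measurable f) (hdep : DependsOn f {x | -(N * η) ≤ dot x u}) :
    Tendsto (fun n => ∫⁻ ω, (op S.full ^ n) f ω ∂μ) atTop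
      (𝓝 (μ Set.univ * ∫⁻ ω, f ω ∂(S.limitLaw P N))) := by
  induction N generalizing f with
  | zero =>
    rw [S.lintegral_limitLaw_zero _ hfm, ← ENNReal.tsum_mul_left]
    refine S.tendsto_of_last μ hf hfm fun i => ?_
    have hm := measurable_op_pow S.measurable_unm i hfm
    have hd : DependsOn ((op S.unm ^ i) f) {x | 0 ≤ dot x u} :=
      dependsOn_op_pow le_rfl S.le_of_unm_ne_zero i (by simpa using hdep)
    -- At depth zero the marked step erases the past completely, so the sequence is already constant
    -- in `n`.
    refine tendsto_const_nhds.congr fun n => ?_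
    rw [← lintegral_push_iterate S.measurable_full _ _ (measurable_op S.measurable_mrk hm),
      (S.fresh_push_full_iterate hP le_rfl hμ n).lintegral_op hP S.pos_η S.measurable_mrk
        S.le_of_mrk_ne_zero S.tsum_mrk hm hd, S.measure_push_full_iterate_univ]
    ring
  | succ N ih =>
    rw [S.lintegral_limitLaw_succ _ _ hfm, ← ENNReal.tsum_mul_left]
    refine S.tendsto_of_last μ hf hfm fun i => ?_
    have hm := measurable_op_pow S.measurable_unm i hfm
    have hη := S.pos_η
    -- The marked step raises the dependence level from `-(N + 1) η` to `-N η`, so the induction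
    -- hypothesis applies to `R K^i f`.
    refine ih (fun ω => ?_) (measurable_op S.measurable_mrk hm) ?_
    · refine (op_le S.tsum_mrk (op_pow_le S.tsum_unm i hf) ω).trans ?_
      rw [mul_one]
      exact mul_le_one' S.ε_le_one (pow_le_one₀ zero_le S.one_sub_lt_one.le)
    · refine dependsOn_of_le_level (le_min ?_ ?_) (dependsOn_op S.le_of_mrk_ne_zero
        (dependsOn_op_pow (neg_nonpos.2 (by positivity)) S.le_of_unm_ne_zero i hdep))
      · exact neg_nonpos.2 (by positivity)
      · push_cast
        linarith

/-- Convergence to the limit law from an initial law that is fresh beyond some level. -/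
lemma tendsto_of_fresh (hP : IsIIDEnvironment P) (N b : ℕ) (μ : Measure (Env d))
    [IsFiniteMeasure μ] (hμ : Fresh P u (b * η) μ) {f : Env d → ℝ≥0∞} (hf : ∀ ω, f ω ≤ 1)
    (hfm : Measurable f) (hdep : DependsOn f {x | -(N * η) ≤ dot x u}) :
    Tendsto (fun n => ∫⁻ ω, (op S.full ^ n) f ω ∂μ) atTop
      (𝓝 (μ Set.univ * ∫⁻ ω, f ω ∂(S.limitLaw P N))) := by
  induction b generalizing μ with
  | zero => exact S.tendsto_of_fresh_zero hP N μ (by simpa using hμ) hf hfm hdep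
  | succ b ih =>
    have hη := S.pos_η
    have hb : (0 : ℝ) ≤ (b + 1 : ℕ) * η := by positivity
    -- The factor `1` is spread over the waiting times `i` before the first marked step, to match
    -- the shape of the limit in `tendsto_of_first`.
    rw [← one_mul (μ Set.univ), ← S.tsum_geometric, ← ENNReal.tsum_mul_right,
      ← ENNReal.tsum_mul_right]
    refine S.tendsto_of_first μ hf hfm fun i => ?_
    have hmass : push S.mrk ((push S.unm)^[i] μ) Set.univ = ε * (1 - ε) ^ i * μ Set.univ := by
      rw [S.measure_push_mrk_univ, S.measure_push_unm_iterate_univ, mul_assoc]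
    have : IsFiniteMeasure (push S.mrk ((push S.unm)^[i] μ)) := ⟨by
      rw [hmass]
      refine ENNReal.mul_lt_top (lt_of_le_of_lt (mul_le_one' S.ε_le_one
        (pow_le_one₀ zero_le S.one_sub_lt_one.le)) ENNReal.one_lt_top) (measure_lt_top _ _)⟩
    rw [← hmass]
    -- The first marked step lowers the frontier from `(b + 1) η` to `b η`.
    refine ih _ ?_
    have := (S.fresh_push_unm_iterate hP hb hμ i).push hP hb S.measurable_mrk S.le_of_mrk_ne_zero
    convert this using 1
    rw [max_eq_right]
    · push_cast; ring
    · push_cast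
      have : 0 ≤ (b : ℝ) * η := by positivity
      linarith

/-- Full steps fix the constant `1`, so convergence tested on it reads off the total mass. -/
lemma isProbabilityMeasure_limitLaw (hP : IsIIDEnvironment P) (N : ℕ) :
    IsProbabilityMeasure (S.limitLaw P N) := by
  have h := S.tendsto_of_fresh_zero hP N P (hP.fresh 0) (f := fun _ => 1) (fun _ => le_rfl)
    measurable_const (fun _ _ _ => rfl)
  simp only [op_pow_const S.tsum_full, one_pow, mul_one, lintegral_const, measure_univ,
    one_mul] at h
  exact ⟨(tendsto_nhds_unique tendsto_const_nhds h).symm⟩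

/-- Consistency needs no computation: both sides are limits of the same sequence. -/
lemma limitLaw_succ_apply (hP : IsIIDEnvironment P) (N : ℕ) {A : Set (Env d)}
    (hA : MeasurableSet A) (hdep : DependsOn (A.indicator fun _ => (1 : ℝ≥0∞))
      {x | -(N * η) ≤ dot x u}) :
    S.limitLaw P (N + 1) A = S.limitLaw P N A := by
  have hη := S.pos_η
  have hle : ∀ ω, A.indicator (fun _ => (1 : ℝ≥0∞)) ω ≤ 1 := fun ω =>
    Set.indicator_le_self' (fun _ _ => zero_le) ω
  have hm : Measurable (A.indicator fun _ => (1 : ℝ≥0∞)) := measurable_const.indicator hA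
  have h1 := S.tendsto_of_fresh_zero hP N P (hP.fresh 0) hle hm hdep
  have h2 := S.tendsto_of_fresh_zero hP (N + 1) P (hP.fresh 0) hle hm
    (dependsOn_of_le_level (by push_cast; linarith) hdep)
  have := tendsto_nhds_unique h2 h1
  simpa [lintegral_indicator hA] using this

end Splitting

/-! ### Absolutely continuous initial laws -/

/-- A three-epsilon argument with additive error bounds on both sides, carried out with `liminf` and
`limsup`. -/
lemma tendsto_of_approx {x : ℕ → ℝ≥0∞} {y : ℕ → ℕ → ℝ≥0∞} {ℓ e : ℕ → ℝ≥0∞} {L : ℝ≥0∞}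
    (he : Tendsto e atTop (𝓝 0)) (he' : ∀ b, e b ≠ ∞)
    (hy : ∀ b, Tendsto (y b) atTop (𝓝 (ℓ b)))
    (h1 : ∀ b n, x n ≤ y b n + e b) (h2 : ∀ b n, y b n ≤ x n + e b)
    (h3 : ∀ b, ℓ b ≤ L + e b) (h4 : ∀ b, L ≤ ℓ b + e b) : Tendsto x atTop (𝓝 L) := by
  have hup : ∀ c : ℝ≥0∞, Tendsto (fun b => c + e b + e b) atTop (𝓝 c) := fun c => by
    simpa using (tendsto_const_nhds.add he).add he
  refine tendsto_of_le_liminf_of_limsup_le ?_ ?_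
  · refine ge_of_tendsto' (hup _) fun b => (h4 b).trans (add_le_add_left ?_ _)
    have hsub : Tendsto (fun n => y b n - e b) atTop (𝓝 (ℓ b - e b)) :=
      ENNReal.Tendsto.sub (hy b) tendsto_const_nhds (Or.inr (he' b))
    have : ℓ b - e b ≤ liminf x atTop := by
      rw [← hsub.liminf_eq]
      exact liminf_le_liminf (Eventually.of_forall fun n => tsub_le_iff_right.2 (h2 b n))
    exact tsub_le_iff_right.1 this
  · refine ge_of_tendsto' (hup _) fun b => ?_
    calc limsup x atTop ≤ limsup (fun n => y b n + e b) atTop :=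
          limsup_le_limsup (Eventually.of_forall (h1 b))
      _ = ℓ b + e b := ((hy b).add tendsto_const_nhds).limsup_eq
      _ ≤ L + e b + e b := add_le_add_left (h3 b) _

/-- The density is unaffected by resampling the sites beyond `b`. -/
lemma fresh_withDensity {d : ℕ} {P : Measure (Env d)} [IsProbabilityMeasure P]
    (hP : IsIIDEnvironment P) {u : Fin d → ℝ} {b : ℝ} {G : Env d → ℝ≥0∞} (hG : Measurable G)
    (hdep : DependsOn G {x | dot x u ≤ b}) : Fresh P u b (P.withDensity G) := by
  intro F hF
  rw [lintegral_withDensity_eq_lintegral_mul _ hG hF,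
    lintegral_withDensity_eq_lintegral_mul _ hG (measurable_lintegral_glue P u b hF),
    hP.fresh (u := u) b _ (hG.mul hF)]
  refine lintegral_congr fun ω => ?_
  have : ∀ ω', G (glue u b ω ω') = G ω := fun ω' => hdep fun x hx => glue_of_le hx _ _
  simp only [Pi.mul_apply, this]
  exact lintegral_const_mul _ (hF.comp (measurable_glue_right u b ω))

/-- The filtration of the half-spaces `{x · u ≤ n η}`. -/
def lowerFiltration {d : ℕ} (u : Fin d → ℝ) (η : ℝ) (hη : 0 < η) :
    Filtration ℕ (MeasurableSpace.pi : MeasurableSpace (Env d)) where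
  seq n := MeasurableSpace.comap ({x : Site d | dot x u ≤ n * η}.domRestrict) MeasurableSpace.pi
  mono' m n hmn := by
    have hle : ∀ x : Site d, dot x u ≤ m * η → dot x u ≤ n * η := fun x hx =>
      hx.trans (mul_le_mul_of_nonneg_right (by exact_mod_cast hmn) hη.le)
    rintro _ ⟨s, hs, rfl⟩
    refine ⟨(fun (f : {x : Site d | dot x u ≤ n * η} → PMF (Site d))
      (x : {x : Site d | dot x u ≤ m * η}) => f ⟨x, hle x x.2⟩) ⁻¹' s, ?_, rfl⟩
    exact (measurable_pi_lambda _ fun x => measurable_pi_apply _) hs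
  le' n := by
    rintro _ ⟨s, hs, rfl⟩
    exact (measurable_pi_lambda _ fun x => measurable_pi_apply _) hs

lemma iSup_lowerFiltration {d : ℕ} (u : Fin d → ℝ) (η : ℝ) (hη : 0 < η) :
    ⨆ n, lowerFiltration u η hη n = (MeasurableSpace.pi : MeasurableSpace (Env d)) := by
  refine le_antisymm (iSup_le fun n => (lowerFiltration u η hη).le n) (iSup_le fun x => ?_)
  obtain ⟨n, hn⟩ := exists_nat_ge (dot x u / η)
  refine le_trans ?_ (le_iSup _ n)
  rintro _ ⟨s, hs, rfl⟩
  exact ⟨(fun f : {x : Site d | dot x u ≤ n * η} → PMF (Site d) =>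
    f ⟨x, (div_le_iff₀ hη).1 hn⟩) ⁻¹' s, measurable_pi_apply _ hs, rfl⟩

lemma dependsOn_of_lowerFiltration {d : ℕ} {u : Fin d → ℝ} {η : ℝ} {hη : 0 < η} {n : ℕ}
    {g : Env d → ℝ} (hg : Measurable[lowerFiltration u η hη n] g) :
    DependsOn g {x | dot x u ≤ n * η} := by
  obtain ⟨g', _, rfl⟩ := hg.exists_eq_measurable_comp
  exact fun ω ω' h => congrArg g' (funext fun x => h x x.2)

namespace Splitting

variable {d : ℕ} {u : Fin d → ℝ} {η : ℝ} {ε : ℝ≥0∞} (S : Splitting u η ε)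
  {P : Measure (Env d)} [IsProbabilityMeasure P]

/-- Conditioning `g` on the sites below level `b η` gives densities whose laws are fresh beyond `b
η`, and these converge to `g` in `L¹`. Since `(op S.full ^ n) f ≤ 1`, the error is at most the `L¹`
distance, uniformly in `n`. The map `ENNReal.ofReal` is 1-Lipschitz, so signs need no attention. -/
lemma tendsto_withDensity (hP : IsIIDEnvironment P) (N : ℕ) {g : Env d → ℝ} (hgm : Measurable g)
    (hg : Integrable g P) {f : Env d → ℝ≥0∞} (hf : ∀ ω, f ω ≤ 1)
    (hfm : Measurable f) (hdep : DependsOn f {x | -(N * η) ≤ dot x u}) :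
    Tendsto (fun n => ∫⁻ ω, ENNReal.ofReal (g ω) * (op S.full ^ n) f ω ∂P) atTop
      (𝓝 ((∫⁻ ω, ENNReal.ofReal (g ω) ∂P) * ∫⁻ ω, f ω ∂(S.limitLaw P N))) := by
  set ℱ := lowerFiltration u η S.pos_η
  set G : ℕ → Env d → ℝ := fun b => P[g | ℱ b]
  have hGm : ∀ b, Measurable[ℱ b] (G b) := fun b => stronglyMeasurable_condExp.measurable
  have hGm' : ∀ b, Measurable (G b) := fun b => (hGm b).mono (ℱ.le b) le_rfl
  have hGi : ∀ b, Integrable (G b) P := fun b => integrable_condExp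
  have hconv : Tendsto (fun b => eLpNorm (G b - g) 1 P) atTop (𝓝 0) := by
    refine hg.tendsto_eLpNorm_condExp ?_
    rw [iSup_lowerFiltration]
    exact hgm.stronglyMeasurable
  have hmeas : ∀ n, Measurable ((op S.full ^ n) f) := fun n =>
    measurable_op_pow S.measurable_full n hfm
  have hq : ∫⁻ ω, f ω ∂(S.limitLaw P N) ≤ 1 := by
    have := S.isProbabilityMeasure_limitLaw hP N
    calc ∫⁻ ω, f ω ∂(S.limitLaw P N) ≤ ∫⁻ _, 1 ∂(S.limitLaw P N) := lintegral_mono hf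
      _ = 1 := by simp
  have hdist : ∀ (g₁ g₂ : Env d → ℝ), Measurable g₁ → Measurable g₂ → ∀ h : Env d → ℝ≥0∞,
      Measurable h → (∀ ω, h ω ≤ 1) →
      ∫⁻ ω, ENNReal.ofReal (g₁ ω) * h ω ∂P ≤
        ∫⁻ ω, ENNReal.ofReal (g₂ ω) * h ω ∂P + eLpNorm (g₁ - g₂) 1 P := by
    intro g₁ g₂ h₁ h₂ h hm hle
    have hm₂ : Measurable fun ω => ENNReal.ofReal (g₂ ω) * h ω := h₂.ennreal_ofReal.mul hm
    rw [eLpNorm_one_eq_lintegral_enorm, ← lintegral_add_left hm₂]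
    refine lintegral_mono fun ω => ?_
    have hr : ENNReal.ofReal (g₁ ω) ≤ ENNReal.ofReal (g₂ ω) + ‖g₁ ω - g₂ ω‖ₑ := by
      rw [Real.enorm_eq_ofReal_abs]
      refine le_trans (ENNReal.ofReal_le_ofReal ?_) ENNReal.ofReal_add_le
      linarith [le_abs_self (g₁ ω - g₂ ω)]
    calc ENNReal.ofReal (g₁ ω) * h ω ≤ (ENNReal.ofReal (g₂ ω) + ‖g₁ ω - g₂ ω‖ₑ) * h ω := by gcongr
      _ = ENNReal.ofReal (g₂ ω) * h ω + ‖g₁ ω - g₂ ω‖ₑ * h ω := add_mul _ _ _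
      _ ≤ ENNReal.ofReal (g₂ ω) * h ω + ‖(g₁ - g₂) ω‖ₑ :=
          add_le_add_right (mul_le_of_le_one_right' (hle ω)) _
  have hmass : ∀ (g₁ g₂ : Env d → ℝ), Measurable g₁ → Measurable g₂ →
      (∫⁻ ω, ENNReal.ofReal (g₁ ω) ∂P) * ∫⁻ ω, f ω ∂(S.limitLaw P N) ≤
        (∫⁻ ω, ENNReal.ofReal (g₂ ω) ∂P) * ∫⁻ ω, f ω ∂(S.limitLaw P N) +
          eLpNorm (g₁ - g₂) 1 P := by
    intro g₁ g₂ h₁ h₂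
    have := hdist g₁ g₂ h₁ h₂ (fun _ => 1) measurable_const (fun _ => le_rfl)
    simp only [mul_one] at this
    calc _ ≤ (∫⁻ ω, ENNReal.ofReal (g₂ ω) ∂P + eLpNorm (g₁ - g₂) 1 P) *
          ∫⁻ ω, f ω ∂(S.limitLaw P N) := by gcongr
      _ ≤ _ := by
        rw [add_mul]
        exact add_le_add_right (mul_le_of_le_one_right' hq) _
  refine tendsto_of_approx hconv (fun b => ?_)
    (y := fun b n => ∫⁻ ω, ENNReal.ofReal (G b ω) * (op S.full ^ n) f ω ∂P)
    (ℓ := fun b => (∫⁻ ω, ENNReal.ofReal (G b ω) ∂P) * ∫⁻ ω, f ω ∂(S.limitLaw P N))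
    (fun b => ?_) (fun b n => ?_) (fun b n => ?_) (fun b => ?_) (fun b => ?_)
  · exact (memLp_one_iff_integrable.2 ((hGi b).sub hg)).2.ne
  · have hGd : DependsOn (fun ω => ENNReal.ofReal (G b ω)) {x | dot x u ≤ b * η} :=
      fun ω ω' h => congrArg _ (dependsOn_of_lowerFiltration (hGm b) h)
    have hfin : IsFiniteMeasure (P.withDensity fun ω => ENNReal.ofReal (G b ω)) :=
      isFiniteMeasure_withDensity_ofReal (hGi b).2
    have := S.tendsto_of_fresh hP N b _ (fresh_withDensity hP (hGm' b).ennreal_ofReal hGd)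
      hf hfm hdep
    rw [withDensity_apply _ MeasurableSet.univ, Measure.restrict_univ] at this
    refine this.congr fun n => ?_
    exact lintegral_withDensity_eq_lintegral_mul _ (hGm' b).ennreal_ofReal (hmeas n)
  · rw [eLpNorm_sub_comm]
    exact hdist _ _ hgm (hGm' b) _ (hmeas n) (S.op_full_pow_le_one n hf)
  · exact hdist _ _ (hGm' b) hgm _ (hmeas n) (S.op_full_pow_le_one n hf)
  · exact hmass _ _ (hGm' b) hgm
  · rw [eLpNorm_sub_comm]
    exact hmass _ _ hgm (hGm' b)

end Splitting

/-! ### ### Laws controlled only on a half-space -/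

/-- The environment equal to `ω` on `{x · u ≥ a}` and to `ω₀` elsewhere. -/
noncomputable def cut {d : ℕ} (u : Fin d → ℝ) (a : ℝ) (ω₀ ω : Env d) : Env d :=
  open Classical in fun x => if a ≤ dot x u then ω x else ω₀ x

lemma cut_of_le {d : ℕ} {u : Fin d → ℝ} {a : ℝ} {x : Site d} (h : a ≤ dot x u) (ω₀ ω : Env d) :
    cut u a ω₀ ω x = ω x := if_pos h

lemma measurable_cut {d : ℕ} (u : Fin d → ℝ) (a : ℝ) (ω₀ : Env d) : Measurable (cut u a ω₀) := by
  refine measurable_pi_lambda _ fun x => ?_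
  by_cases h : a ≤ dot x u
  · simp only [cut_of_le h]
    exact measurable_pi_apply x
  · simp only [cut, if_neg h]
    exact measurable_const

lemma dependsOn_comp_cut {d : ℕ} {β : Type*} (u : Fin d → ℝ) (a : ℝ) (ω₀ : Env d)
    (f : Env d → β) : DependsOn (fun ω => f (cut u a ω₀ ω)) {x | a ≤ dot x u} := by
  intro ω ω' h
  refine congrArg f (funext fun x => ?_)
  by_cases hx : a ≤ dot x u
  · rw [cut_of_le hx, cut_of_le hx, h x hx]
  · simp only [cut, if_neg hx]

lemma apply_cut {d : ℕ} {β : Type*} {u : Fin d → ℝ} {a : ℝ} {f : Env d → β}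
    (hf : DependsOn f {x | a ≤ dot x u}) (ω₀ ω : Env d) : f (cut u a ω₀ ω) = f ω :=
  hf fun _ hx => cut_of_le hx _ _

/-- Sets depending only on the environment on `{x · u ≥ a}`. -/
def IsUpper {d : ℕ} (u : Fin d → ℝ) (a : ℝ) (A : Set (Env d)) : Prop :=
  DependsOn (· ∈ A) {x : Site d | a ≤ dot x u}

lemma IsUpper.dependsOn_indicator {d : ℕ} {u : Fin d → ℝ} {a : ℝ} {A : Set (Env d)}
    (hA : IsUpper u a A) : DependsOn (A.indicator fun _ => (1 : ℝ≥0∞)) {x | a ≤ dot x u} := by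
  classical
  intro ω ω' h
  simp only [Set.indicator_apply, hA h]

/-- Absolute continuity on the events of the half-space `{x · u ≥ a}`. -/
def UpperAbsCont {d : ℕ} (u : Fin d → ℝ) (a : ℝ) (μ ν : Measure (Env d)) : Prop :=
  ∀ A, MeasurableSet A → IsUpper u a A → ν A = 0 → μ A = 0

namespace Splitting

variable {d : ℕ} {u : Fin d → ℝ} {η : ℝ} {ε : ℝ≥0∞} (S : Splitting u η ε)
  {P : Measure (Env d)} [IsProbabilityMeasure P]

/-- Freezing the sites below level `-N η` by `cut` turns absolute continuity on half-space events
into absolute continuity of image measures. This yields a Radon-Nikodym density that represents `μ`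
on functions of the half-space, which includes all `(op S.full ^ n) f`. -/
lemma tendsto_of_upperAbsCont (hP : IsIIDEnvironment P) (N : ℕ) (μ : Measure (Env d))
    [IsFiniteMeasure μ] (hμ : UpperAbsCont u (-(N * η)) μ P) {f : Env d → ℝ≥0∞}
    (hf : ∀ ω, f ω ≤ 1) (hfm : Measurable f) (hdep : DependsOn f {x | -(N * η) ≤ dot x u}) :
    Tendsto (fun n => ∫⁻ ω, (op S.full ^ n) f ω ∂μ) atTop
      (𝓝 (μ Set.univ * ∫⁻ ω, f ω ∂(S.limitLaw P N))) := by
  obtain ⟨ω₀⟩ : Nonempty (Env d) := ⟨fun _ => PMF.pure 0⟩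
  set r := cut u (-(N * η)) ω₀
  have hr : Measurable r := measurable_cut _ _ _
  have hac : μ.map r ≪ P.map r := by
    refine Measure.AbsolutelyContinuous.mk fun A hA h0 => ?_
    rw [Measure.map_apply hr hA] at h0 ⊢
    exact hμ _ (hr hA) (dependsOn_comp_cut u _ ω₀ (· ∈ A)) h0
  set g := (μ.map r).rnDeriv (P.map r)
  have hgm : Measurable g := Measure.measurable_rnDeriv _ _
  have hint : ∀ h : Env d → ℝ≥0∞, Measurable h → DependsOn h {x | -(N * η) ≤ dot x u} →
      ∫⁻ ω, h ω ∂μ = ∫⁻ ω, ENNReal.ofReal (g (r ω)).toReal * h ω ∂P := by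
    intro h hm hd
    have hfin : ∀ᵐ ω ∂P, g (r ω) < ∞ :=
      ae_of_ae_map hr.aemeasurable (Measure.rnDeriv_lt_top (μ.map r) (P.map r))
    calc ∫⁻ ω, h ω ∂μ = ∫⁻ ω, h (r ω) ∂μ := lintegral_congr fun ω => (apply_cut hd ω₀ ω).symm
      _ = ∫⁻ ω, h ω ∂(μ.map r) := (lintegral_map hm hr).symm
      _ = ∫⁻ ω, g ω * h ω ∂(P.map r) := by
        rw [← Measure.withDensity_rnDeriv_eq _ _ hac]
        exact lintegral_withDensity_eq_lintegral_mul _ hgm hm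
      _ = ∫⁻ ω, g (r ω) * h (r ω) ∂P := lintegral_map (hgm.mul hm) hr
      _ = _ := by
        refine lintegral_congr_ae ?_
        filter_upwards [hfin] with ω hω
        rw [apply_cut hd ω₀ ω, ENNReal.ofReal_toReal hω.ne]
  have hN : -((N : ℝ) * η) ≤ 0 := neg_nonpos.2 (mul_nonneg N.cast_nonneg S.pos_η.le)
  have h1 : μ Set.univ = ∫⁻ ω, ENNReal.ofReal (g (r ω)).toReal ∂P := by
    have := hint (fun _ => 1) measurable_const (fun _ _ _ => rfl)
    simpa using this
  have hgi : Integrable (fun ω => (g (r ω)).toReal) P := by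
    refine ⟨(hgm.comp hr).ennreal_toReal.aestronglyMeasurable, ?_⟩
    rw [hasFiniteIntegral_iff_ofReal (Eventually.of_forall fun _ => ENNReal.toReal_nonneg), ← h1]
    exact measure_lt_top _ _
  rw [h1]
  refine (S.tendsto_withDensity hP N (hgm.comp hr).ennreal_toReal hgi hf hfm hdep).congr
    fun n => ?_
  exact (hint _ (measurable_op_pow S.measurable_full n hfm)
    (dependsOn_op_pow hN S.le_of_full_ne_zero n hdep)).symm

end Splitting

/-! ### Extension of consistent families of laws -/

/-- Probability vectors form a measurable subset of a countable product of Polish spaces. The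
instance makes conditional distributions of environments available. -/
instance instStandardBorelSpacePMF {α : Type*} [Countable α] : StandardBorelSpace (PMF α) := by
  have h : MeasurableSet {f : α → ℝ≥0∞ | HasSum f 1} := by
    have : {f : α → ℝ≥0∞ | HasSum f 1} = {f | ∑' a, f a = 1} := by
      ext f
      exact ENNReal.summable.hasSum_iff
    rw [this]
    exact measurableSet_eq_fun (Measurable.tsum fun a => measurable_pi_apply a) measurable_const
  exact h.standardBorel

instance instNonemptyPMFSite {d : ℕ} : Nonempty (PMF (Site d)) := ⟨PMF.pure 0⟩

lemma measurableEq_of_standardBorelSpace {Ω : Type*} [MeasurableSpace Ω] [StandardBorelSpace Ω] :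
    MeasurableEq Ω := by
  let := upgradeStandardBorel Ω
  exact ⟨isClosed_diagonal.measurableSet⟩

lemma map_eval_zero_trajMeasure {Ω : Type*} [MeasurableSpace Ω] (μ : Measure Ω)
    [IsProbabilityMeasure μ]
    (κ : (n : ℕ) → Kernel ((i : Finset.Iic n) → Ω) Ω) [∀ n, IsMarkovKernel (κ n)] :
    (Kernel.trajMeasure (X := fun _ => Ω) μ κ).map (fun w => w 0) = μ := by
  have h0 : Measurable (fun h : (i : Finset.Iic 0) → Ω => h ⟨0, Finset.mem_Iic.2 le_rfl⟩) :=
    measurable_pi_apply _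
  have h1 : (fun w : ℕ → Ω => w 0) = (fun h : (i : Finset.Iic 0) → Ω =>
      h ⟨0, Finset.mem_Iic.2 le_rfl⟩) ∘ Preorder.frestrictLe 0 := rfl
  rw [h1, ← Measure.map_map h0 (Preorder.measurable_frestrictLe 0), Kernel.trajMeasure,
    Measure.map_comp _ _ (Preorder.measurable_frestrictLe 0), Kernel.traj_map_frestrictLe,
    Kernel.partialTraj_self, Measure.id_comp, Measure.map_map h0 (MeasurableEquiv.measurable _)]
  exact Measure.map_id

/-- A sequence of laws which is consistent along reductions `r n` extends to a single law. -/
lemma exists_measure_of_consistent {Ω : Type*} [MeasurableSpace Ω] [StandardBorelSpace Ω]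
    [Nonempty Ω] (Q : ℕ → Measure Ω) [∀ n, IsProbabilityMeasure (Q n)] (r : ℕ → Ω → Ω)
    (hr : ∀ n, Measurable (r n)) (hQ : ∀ n, (Q (n + 1)).map (r n) = (Q n).map (r n))
    (L : (ℕ → Ω) → Ω) (hL : Measurable L)
    (hrL : ∀ w : ℕ → Ω, (∀ n, r n (w (n + 1)) = r n (w n)) → ∀ n, r n (L w) = r n (w n)) :
    ∃ Q' : Measure Ω, IsProbabilityMeasure Q' ∧ ∀ n, Q'.map (r n) = (Q n).map (r n) := by
  have : MeasurableEq Ω := measurableEq_of_standardBorelSpace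
  have he : ∀ n, Measurable (fun h : (i : Finset.Iic n) → Ω =>
      r n (h ⟨n, Finset.mem_Iic.2 le_rfl⟩)) := fun n => (hr n).comp (measurable_pi_apply _)
  -- The next state is drawn from `Q (n + 1)` conditioned on its reduction being that of the present
  -- state.
  let κ : (n : ℕ) → Kernel ((i : Finset.Iic n) → Ω) Ω := fun n =>
    (condDistrib id (r n) (Q (n + 1))).comap _ (he n)
  have : ∀ n, IsMarkovKernel (κ n) := fun n => Kernel.IsMarkovKernel.comap _ (he n)
  set T := Kernel.trajMeasure (X := fun _ => Ω) (Q 0) κ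
  have hjoint : ∀ n, T.map (fun w => w n) = Q n →
      T.map (fun w => (r n (w n), w (n + 1))) = (Q (n + 1)).map fun ω => (r n ω, ω) := by
    intro n hn
    have h1 : Measurable fun w : ℕ → Ω => (r n (w n), w (n + 1)) :=
      ((hr n).comp (measurable_pi_apply n)).prodMk (measurable_pi_apply (n + 1))
    have h2 : Measurable fun w : ℕ → Ω => (Preorder.frestrictLe (π := fun _ => Ω) n w, w (n + 1)) :=
      (Preorder.measurable_frestrictLe n).prodMk (measurable_pi_apply (n + 1))
    refine Measure.ext_of_lintegral _ fun F hF => ?_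
    have hm := Kernel.map_frestrictLe_trajMeasure_compProd_eq_map_trajMeasure
      (X := fun _ => Ω) (μ₀ := Q 0) (κ := κ) (a := n)
    have hF' : Measurable fun q : ((i : Finset.Iic n) → Ω) × Ω =>
        F (r n (q.1 ⟨n, Finset.mem_Iic.2 le_rfl⟩), q.2) :=
      hF.comp (((he n).comp measurable_fst).prodMk measurable_snd)
    have hK : Measurable fun x => ∫⁻ y, F (x, y) ∂(condDistrib id (r n) (Q (n + 1)) x) :=
      hF.lintegral_kernel_prod_right'
    calc ∫⁻ q, F q ∂(T.map (fun w => (r n (w n), w (n + 1))))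
        = ∫⁻ w, F (r n (w n), w (n + 1)) ∂T := lintegral_map hF h1
      _ = ∫⁻ q, F (r n (q.1 ⟨n, Finset.mem_Iic.2 le_rfl⟩), q.2)
            ∂(T.map fun w => (Preorder.frestrictLe n w, w (n + 1))) :=
          (lintegral_map hF' h2).symm
      _ = ∫⁻ h, ∫⁻ y, F (r n (h ⟨n, Finset.mem_Iic.2 le_rfl⟩), y) ∂(κ n h)
            ∂(T.map (Preorder.frestrictLe n)) := by
          rw [← hm, Measure.lintegral_compProd hF']
      _ = ∫⁻ w, ∫⁻ y, F (r n (w n), y) ∂(condDistrib id (r n) (Q (n + 1)) (r n (w n))) ∂T :=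
          lintegral_map (hK.comp (he n)) (Preorder.measurable_frestrictLe n)
      _ = ∫⁻ ω, ∫⁻ y, F (r n ω, y) ∂(condDistrib id (r n) (Q (n + 1)) (r n ω)) ∂(Q n) := by
          rw [← hn]
          exact (lintegral_map (hK.comp (hr n)) (measurable_pi_apply n)).symm
      _ = ∫⁻ x, ∫⁻ y, F (x, y) ∂(condDistrib id (r n) (Q (n + 1)) x) ∂((Q (n + 1)).map (r n)) := by
          rw [hQ n, lintegral_map hK (hr n)]
      _ = ∫⁻ q, F q ∂((Q (n + 1)).map fun ω => (r n ω, ω)) := by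
          rw [← Measure.lintegral_compProd hF, compProd_map_condDistrib aemeasurable_id]
          rfl
  have hmarg : ∀ n, T.map (fun w => w n) = Q n := by
    intro n
    induction n with
    | zero => exact map_eval_zero_trajMeasure _ _
    | succ n ih =>
      have h1 : Measurable fun w : ℕ → Ω => (r n (w n), w (n + 1)) :=
        ((hr n).comp (measurable_pi_apply n)).prodMk (measurable_pi_apply (n + 1))
      have h2 : Measurable fun ω : Ω => (r n ω, ω) := (hr n).prodMk measurable_id
      have h := congrArg (Measure.map Prod.snd) (hjoint n ih)
      rw [Measure.map_map measurable_snd h1, Measure.map_map measurable_snd h2] at h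
      exact h.trans Measure.map_id
  have hae : ∀ᵐ w ∂T, ∀ n, r n (w (n + 1)) = r n (w n) := by
    refine ae_all_iff.2 fun n => ?_
    have h1 : Measurable fun w : ℕ → Ω => (r n (w n), w (n + 1)) :=
      ((hr n).comp (measurable_pi_apply n)).prodMk (measurable_pi_apply (n + 1))
    have hset : MeasurableSet {q : Ω × Ω | r n q.2 = q.1} :=
      measurableSet_eq_fun ((hr n).comp measurable_snd) measurable_fst
    refine (ae_map_iff h1.aemeasurable hset).1 ?_
    have h2 : Measurable fun ω : Ω => (r n ω, ω) := (hr n).prodMk measurable_id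
    rw [hjoint n (hmarg n), ae_map_iff h2.aemeasurable hset]
    exact Eventually.of_forall fun _ => rfl
  -- Along the chain the reductions agree almost surely and each marginal is `Q n`, so the law of
  -- the limit point `L w` has all the required reductions.
  refine ⟨T.map L, Measure.isProbabilityMeasure_map hL.aemeasurable, fun n => ?_⟩
  rw [← hmarg n, Measure.map_map (hr n) hL, Measure.map_map (hr n) (measurable_pi_apply n)]
  refine Measure.map_congr ?_
  filter_upwards [hae] with w hw using hrL w hw n

namespace Splitting

variable {d : ℕ} {u : Fin d → ℝ} {η : ℝ} {ε : ℝ≥0∞} (S : Splitting u η ε)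
  {P : Measure (Env d)} [IsProbabilityMeasure P]

/-- The limit laws on half-spaces extend to a probability measure on all environments. -/
lemma exists_stationaryLaw (hP : IsIIDEnvironment P) :
    ∃ Q : Measure (Env d), IsProbabilityMeasure Q ∧ ∀ (N : ℕ) (A : Set (Env d)),
      MeasurableSet A → IsUpper u (-(N * η)) A → Q A = S.limitLaw P N A := by
  have := S.isProbabilityMeasure_limitLaw hP
  have hη := S.pos_η
  obtain ⟨ω₀⟩ : Nonempty (Env d) := ⟨fun _ => PMF.pure 0⟩
  set r : ℕ → Env d → Env d := fun n => cut u (-(n * η)) ω₀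
  have hr : ∀ n, Measurable (r n) := fun n => measurable_cut _ _ _
  have hN : ∀ x : Site d, ∃ n : ℕ, -(n * η) ≤ dot x u := fun x => by
    obtain ⟨n, hn⟩ := exists_nat_ge (-dot x u / η)
    exact ⟨n, by linarith [(div_le_iff₀ hη).1 hn]⟩
  -- The site `x` is visible from depth `N x` on, so the limit environment takes its value at `x`
  -- from the state with that index.
  choose N hN using hN
  have hcons : ∀ n, (S.limitLaw P (n + 1)).map (r n) = (S.limitLaw P n).map (r n) := by
    intro n
    refine Measure.ext fun A hA => ?_
    rw [Measure.map_apply (hr n) hA, Measure.map_apply (hr n) hA]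
    have hup : IsUpper u (-(n * η)) (r n ⁻¹' A) := dependsOn_comp_cut u _ ω₀ (· ∈ A)
    exact S.limitLaw_succ_apply hP n (hr n hA) hup.dependsOn_indicator
  have hlim : ∀ w : ℕ → Env d, (∀ n, r n (w (n + 1)) = r n (w n)) →
      ∀ n, r n (fun x => w (N x) x) = r n (w n) := by
    intro w hw n
    have hconst : ∀ x (m k : ℕ), -(m * η) ≤ dot x u → w (m + k) x = w m x := by
      intro x m k hx
      induction k with
      | zero => rfl
      | succ k ih =>
        have hx' : -((m + k : ℕ) * η) ≤ dot x u := by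
          push_cast
          have : 0 ≤ (k : ℝ) * η := by positivity
          linarith
        have := congrFun (hw (m + k)) x
        simp only [r, cut_of_le hx'] at this
        rw [← ih, ← this]
        rfl
    funext x
    by_cases hx : -(n * η) ≤ dot x u
    · simp only [r, cut_of_le hx]
      rcases le_total n (N x) with h | h
      · obtain ⟨k, hk⟩ := Nat.exists_eq_add_of_le h
        rw [hk, hconst x n k hx]
      · obtain ⟨k, hk⟩ := Nat.exists_eq_add_of_le h
        conv_rhs => rw [hk]
        rw [hconst x (N x) k (hN x)]
    · simp only [r, cut, if_neg hx]
  obtain ⟨Q, hQ, hQr⟩ := exists_measure_of_consistent (S.limitLaw P) r hr hcons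
    (fun w x => w (N x) x)
    (measurable_pi_lambda _ fun x => (measurable_pi_apply x).comp (measurable_pi_apply (N x))) hlim
  refine ⟨Q, hQ, fun n A hA hup => ?_⟩
  have hpre : r n ⁻¹' A = A := by
    ext ω
    exact iff_of_eq (apply_cut hup ω₀ ω)
  have := congrArg (· A) (hQr n)
  simpa only [Measure.map_apply (hr n) hA, hpre] using this

end Splitting

/-! ### Half-space events -/

lemma IsUpper.mono {d : ℕ} {u : Fin d → ℝ} {a b : ℝ} (hab : a ≤ b) {A : Set (Env d)}
    (h : IsUpper u b A) : IsUpper u a A :=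
  dependsOn_of_le_level hab h

lemma isUpper_of_measurableSet {d : ℕ} {u : Fin d → ℝ} {k : ℤ} {A : Set (Env d)}
    (hA : MeasurableSet[halfSpace u k] A) : IsUpper u k A := by
  have hle : halfSpace u k ≤ MeasurableSpace.comap
      ({x : Site d | (k : ℝ) ≤ dot x u}.domRestrict) MeasurableSpace.pi := by
    refine iSup_le fun x => ?_
    rintro _ ⟨s, hs, rfl⟩
    exact ⟨(fun f : {x : Site d | (k : ℝ) ≤ dot x u} → PMF (Site d) => f x) ⁻¹' s,
      measurable_pi_apply _ hs, rfl⟩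
  obtain ⟨s, _, rfl⟩ := hle _ hA
  exact fun ω ω' h => congrArg (· ∈ s) (funext fun x => h x x.2)

/-- Such an event is its own preimage under `cut`, and `cut` is measurable for the half-space
σ-field. -/
lemma IsUpper.measurableSet_halfSpace {d : ℕ} {u : Fin d → ℝ} {k : ℤ} {A : Set (Env d)}
    (hA : MeasurableSet A) (h : IsUpper u k A) : MeasurableSet[halfSpace u k] A := by
  obtain ⟨ω₀⟩ : Nonempty (Env d) := ⟨fun _ => PMF.pure 0⟩
  have hm : Measurable[halfSpace u k] (cut u k ω₀) := by
    refine @measurable_pi_lambda _ _ _ (halfSpace u k) _ _ fun x => ?_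
    by_cases hx : (k : ℝ) ≤ dot x u
    · simp only [cut_of_le hx]
      exact Measurable.of_comap_le (le_iSup (fun x : {x : Site d // (k : ℝ) ≤ dot x u} =>
        MeasurableSpace.comap (fun ω : Env d => ω x) instMeasurableSpacePMF) ⟨x, hx⟩)
    · simp only [cut, if_neg hx]
      exact measurable_const
  have : A = cut u k ω₀ ⁻¹' A := by
    ext ω
    exact (iff_of_eq (apply_cut h ω₀ ω)).symm
  rw [this]
  exact hm hA

lemma isUpper_eval_preimage {d : ℕ} (u : Fin d → ℝ) (x : Site d) (s : Set (PMF (Site d))) :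
    IsUpper u (dot x u) ((fun ω : Env d => ω x) ⁻¹' s) :=
  fun _ _ h => congrArg (· ∈ s) (h x (le_refl (dot x u)))

lemma exists_nat_neg_mul_le {η : ℝ} (hη : 0 < η) (a : ℝ) : ∃ N : ℕ, -(N * η) ≤ a := by
  obtain ⟨n, hn⟩ := exists_nat_ge (-a / η)
  exact ⟨n, by linarith [(div_le_iff₀ hη).1 hn]⟩

/-- The measurable events that depend only on the environment on some half-space. -/
def upperEvents {d : ℕ} (u : Fin d → ℝ) (η : ℝ) : Set (Set (Env d)) :=
  {A | MeasurableSet A ∧ ∃ N : ℕ, IsUpper u (-(N * η)) A}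

lemma generateFrom_upperEvents {d : ℕ} (u : Fin d → ℝ) {η : ℝ} (hη : 0 < η) :
    (MeasurableSpace.pi : MeasurableSpace (Env d)) =
      MeasurableSpace.generateFrom (upperEvents u η) := by
  refine le_antisymm (iSup_le fun x => ?_) (MeasurableSpace.generateFrom_le fun A hA => hA.1)
  rintro _ ⟨s, hs, rfl⟩
  obtain ⟨N, hN⟩ := exists_nat_neg_mul_le hη (dot x u)
  exact MeasurableSpace.measurableSet_generateFrom
    ⟨measurable_pi_apply x hs, N, (isUpper_eval_preimage u x s).mono hN⟩

lemma isPiSystem_upperEvents {d : ℕ} (u : Fin d → ℝ) {η : ℝ} (hη : 0 < η) :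
    IsPiSystem (upperEvents u η) := by
  rintro A ⟨hA, M, hM⟩ B ⟨hB, N, hN⟩ -
  refine ⟨hA.inter hB, max M N, fun ω ω' H => ?_⟩
  have h1 : -((max M N : ℕ) * η) ≤ -(M * η) :=
    neg_le_neg (mul_le_mul_of_nonneg_right (by exact_mod_cast le_max_left M N) hη.le)
  have h2 : -((max M N : ℕ) * η) ≤ -(N * η) :=
    neg_le_neg (mul_le_mul_of_nonneg_right (by exact_mod_cast le_max_right M N) hη.le)
  exact congrArg₂ And (hM.mono h1 H) (hN.mono h2 H)

/-- Finite measures that agree on half-space events are equal. -/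
lemma ext_of_isUpper {d : ℕ} {u : Fin d → ℝ} {η : ℝ} (hη : 0 < η) {μ ν : Measure (Env d)}
    [IsFiniteMeasure μ]
    (h : ∀ (N : ℕ) (A : Set (Env d)), MeasurableSet A → IsUpper u (-(N * η)) A → μ A = ν A) :
    μ = ν :=
  ext_of_generate_finite _ (generateFrom_upperEvents u hη) (isPiSystem_upperEvents u hη)
    (fun A hA => hA.2.elim fun N hN => h N A hA.1 hN) (h 0 _ MeasurableSet.univ fun _ _ _ => rfl)

lemma indicator_one_le {α : Type*} (A : Set α) (a : α) :
    A.indicator (fun _ => (1 : ℝ≥0∞)) a ≤ 1 :=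
  Set.indicator_le_self' (fun _ _ => zero_le) a

lemma lintegral_indicator_const_one {α : Type*} [MeasurableSpace α] (μ : Measure α) {A : Set α}
    (hA : MeasurableSet A) : ∫⁻ a, A.indicator (fun _ => (1 : ℝ≥0∞)) a ∂μ = μ A :=
  lintegral_indicator_one hA

/-- Although `P` is not invariant for the kernel, each shift preserves it and there are countably
many shifts. Hence null functions stay null, which lets absolute continuity pass to the limit. -/
lemma op_eq_zero_ae {d : ℕ} {P : Measure (Env d)} (hP : IsIIDEnvironment P)
    (w : PMF (Site d) → Site d → ℝ≥0∞) {f : Env d → ℝ≥0∞} (hf : f =ᵐ[P] 0) : op w f =ᵐ[P] 0 := by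
  have h : ∀ᵐ ω ∂P, ∀ z, f (shift z ω) = 0 := by
    refine ae_all_iff.2 fun z => ?_
    have hf' : ∀ᵐ ω ∂(P.map (shift z)), f ω = 0 := by
      rw [hP.map_shift z]
      exact hf
    exact ae_of_ae_map (measurable_shift_const z).aemeasurable hf'
  filter_upwards [h] with ω hω
  simp [op_apply, hω]

lemma op_pow_eq_zero_ae {d : ℕ} {P : Measure (Env d)} (hP : IsIIDEnvironment P)
    (w : PMF (Site d) → Site d → ℝ≥0∞) (n : ℕ) {f : Env d → ℝ≥0∞} (hf : f =ᵐ[P] 0) :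
    (op w ^ n) f =ᵐ[P] 0 := by
  induction n generalizing f with
  | zero => simpa using hf
  | succ n ih =>
    rw [pow_succ]
    exact ih (op_eq_zero_ae hP w hf)

/-! ### The stationary law -/

namespace Splitting

variable {d : ℕ} {u : Fin d → ℝ} {η : ℝ} {ε : ℝ≥0∞} (S : Splitting u η ε)
  {P : Measure (Env d)}

/-- `Q` extends the limit laws on half-spaces. -/
def IsStationaryLaw (P Q : Measure (Env d)) : Prop :=
  ∀ (N : ℕ) (A : Set (Env d)), MeasurableSet A → IsUpper u (-(N * η)) A →
    Q A = S.limitLaw P N A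

variable {S} {Q : Measure (Env d)}

lemma IsStationaryLaw.lintegral_eq (hQ : S.IsStationaryLaw P Q) (N : ℕ) {f : Env d → ℝ≥0∞}
    (hfm : Measurable f) (hdep : DependsOn f {x | -(N * η) ≤ dot x u}) :
    ∫⁻ ω, f ω ∂Q = ∫⁻ ω, f ω ∂(S.limitLaw P N) := by
  obtain ⟨ω₀⟩ : Nonempty (Env d) := ⟨fun _ => PMF.pure 0⟩
  have hr := measurable_cut u (-(N * η)) ω₀
  have hmap : Q.map (cut u (-(N * η)) ω₀) = (S.limitLaw P N).map (cut u (-(N * η)) ω₀) := by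
    refine Measure.ext fun A hA => ?_
    rw [Measure.map_apply hr hA, Measure.map_apply hr hA]
    exact hQ N _ (hr hA) (dependsOn_comp_cut u _ ω₀ (· ∈ A))
  have : ∀ μ : Measure (Env d), ∫⁻ ω, f ω ∂μ = ∫⁻ ω, f ω ∂(μ.map (cut u (-(N * η)) ω₀)) :=
    fun μ => by
      rw [lintegral_map hfm hr]
      exact lintegral_congr fun ω => (apply_cut hdep ω₀ ω).symm
  rw [this Q, hmap, ← this]

/-- Age zero alone contributes `ε P A` to the series for the limit law. This gives `P ≪ Q` on the
half-space at level `0`. -/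
lemma IsStationaryLaw.mul_le_apply (hQ : S.IsStationaryLaw P Q)
    {A : Set (Env d)} (hA : MeasurableSet A) (hup : IsUpper u 0 A) : ε * P A ≤ Q A := by
  have hm : Measurable (A.indicator fun _ => (1 : ℝ≥0∞)) := measurable_const.indicator hA
  rw [hQ 0 A hA (by simpa using hup), ← lintegral_indicator_const_one (S.limitLaw P 0) hA,
    S.lintegral_limitLaw_zero P hm]
  refine le_trans (le_of_eq ?_) (ENNReal.le_tsum 0)
  rw [pow_zero, ← lintegral_indicator_const_one P hA]
  rfl

variable [IsProbabilityMeasure P]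

lemma IsStationaryLaw.tendsto (hP : IsIIDEnvironment P) (hQ : S.IsStationaryLaw P Q)
    (μ : Measure (Env d)) [IsFiniteMeasure μ] (N : ℕ) (hμ : UpperAbsCont u (-(N * η)) μ P)
    {f : Env d → ℝ≥0∞} (hf : ∀ ω, f ω ≤ 1) (hfm : Measurable f)
    (hdep : DependsOn f {x | -(N * η) ≤ dot x u}) :
    Tendsto (fun n => ∫⁻ ω, (op S.full ^ n) f ω ∂μ) atTop
      (𝓝 (μ Set.univ * ∫⁻ ω, f ω ∂Q)) := by
  rw [hQ.lintegral_eq N hfm hdep]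
  exact S.tendsto_of_upperAbsCont hP N μ hμ hf hfm hdep

lemma IsStationaryLaw.tendsto_self (hP : IsIIDEnvironment P) (hQ : S.IsStationaryLaw P Q)
    (N : ℕ) {f : Env d → ℝ≥0∞} (hf : ∀ ω, f ω ≤ 1) (hfm : Measurable f)
    (hdep : DependsOn f {x | -(N * η) ≤ dot x u}) :
    Tendsto (fun n => ∫⁻ ω, (op S.full ^ n) f ω ∂P) atTop (𝓝 (∫⁻ ω, f ω ∂Q)) := by
  simpa using hQ.tendsto hP P N (fun _ _ _ h => h) hf hfm hdep

lemma IsStationaryLaw.upperAbsCont (hP : IsIIDEnvironment P) (hQ : S.IsStationaryLaw P Q)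
    (N : ℕ) : UpperAbsCont u (-(N * η)) Q P := by
  intro A hA hup h0
  have h := hQ.tendsto_self hP N (indicator_one_le A) (measurable_const.indicator hA)
    hup.dependsOn_indicator
  rw [lintegral_indicator_const_one Q hA] at h
  refine tendsto_nhds_unique h (tendsto_const_nhds.congr fun n => ?_)
  have hz : (A.indicator fun _ => (1 : ℝ≥0∞)) =ᵐ[P] 0 := by
    filter_upwards [measure_eq_zero_iff_ae_notMem.1 h0] with ω hω
    simp [hω]
  rw [lintegral_congr_ae (op_pow_eq_zero_ae hP S.full n hz)]
  simp

/-- The limits along `n + 1` for `f` and along `n` for `op S.full f` coincide. -/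
lemma IsStationaryLaw.push_full [IsFiniteMeasure Q] (hP : IsIIDEnvironment P)
    (hQ : S.IsStationaryLaw P Q) : push S.full Q = Q := by
  refine (ext_of_isUpper (u := u) S.pos_η fun N A hA hup => ?_).symm
  have hm : Measurable (A.indicator fun _ => (1 : ℝ≥0∞)) := measurable_const.indicator hA
  have hN : -((N : ℝ) * η) ≤ 0 := neg_nonpos.2 (mul_nonneg N.cast_nonneg S.pos_η.le)
  rw [← lintegral_indicator_const_one _ hA, ← lintegral_indicator_const_one _ hA,
    lintegral_push S.measurable_full _ hm]
  have h1 := hQ.tendsto_self hP N (indicator_one_le A) hm hup.dependsOn_indicator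
  have h2 := hQ.tendsto_self hP N (S.op_full_pow_le_one 1 (indicator_one_le A))
    (measurable_op_pow S.measurable_full 1 hm)
    (dependsOn_op_pow hN S.le_of_full_ne_zero 1 hup.dependsOn_indicator)
  simp only [pow_one] at h2
  refine tendsto_nhds_unique ((tendsto_add_atTop_iff_nat 1).2 h1) (h2.congr fun n => ?_)
  rw [pow_succ]
  rfl

/-- Started from an invariant law the sequence is constant, yet it converges to the value under `Q`.
-/
lemma IsStationaryLaw.eq_of_push_full [IsProbabilityMeasure Q] (hP : IsIIDEnvironment P)
    (hQ : S.IsStationaryLaw P Q) {Q' : Measure (Env d)} [IsProbabilityMeasure Q']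
    (hac : ∀ N : ℕ, UpperAbsCont u (-(N * η)) Q' P) (hinv : push S.full Q' = Q') : Q' = Q := by
  refine ext_of_isUpper (u := u) S.pos_η fun N A hA hup => ?_
  have hm : Measurable (A.indicator fun _ => (1 : ℝ≥0∞)) := measurable_const.indicator hA
  have h := hQ.tendsto hP Q' N (hac N) (indicator_one_le A) hm hup.dependsOn_indicator
  rw [measure_univ, one_mul, lintegral_indicator_const_one _ hA] at h
  refine tendsto_nhds_unique (tendsto_const_nhds.congr fun n => ?_) h
  rw [← lintegral_push_iterate S.measurable_full _ _ hm, Function.iterate_fixed hinv,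
    lintegral_indicator_const_one _ hA]

/-- Sites at a strictly positive level are beyond the frontier at every time, so their law is `P`
for each `n` and not only in the limit. -/
lemma IsStationaryLaw.apply_eq_of_pos (hP : IsIIDEnvironment P) (hQ : S.IsStationaryLaw P Q)
    {a : ℝ} (ha : 0 < a) {A : Set (Env d)} (hA : MeasurableSet A) (hup : IsUpper u a A) :
    P A = Q A := by
  have hm : Measurable (A.indicator fun _ => (1 : ℝ≥0∞)) := measurable_const.indicator hA
  have h := hQ.tendsto_self hP 0 (indicator_one_le A) hm
    (hup.mono (by simpa using ha.le)).dependsOn_indicator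
  rw [lintegral_indicator_const_one _ hA] at h
  refine tendsto_nhds_unique (tendsto_const_nhds.congr fun n => ?_) h
  rw [← lintegral_push_iterate S.measurable_full _ _ hm,
    S.fresh_push_full_iterate hP le_rfl (hP.fresh 0) n _ hm]
  have : ∀ ω ω' : Env d, A.indicator (fun _ => (1 : ℝ≥0∞)) (glue u 0 ω ω') =
      A.indicator (fun _ => (1 : ℝ≥0∞)) ω' := fun ω ω' =>
    hup.dependsOn_indicator fun x (hx : a ≤ dot x u) => glue_of_lt (ha.trans_le hx) _ _
  simp only [this, lintegral_indicator_const_one P hA, lintegral_const,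
    S.measure_push_full_iterate_univ, measure_univ, mul_one]

end Splitting

/-! ### First-step analysis and ergodicity of Markov chains -/

section Markov

variable {S : Type*} [MeasurableSpace S]

/-- The path `x, w 0, w 1, …`. -/
def pathCons (x : S) (w : ℕ → S) : ℕ → S
  | 0 => x
  | n + 1 => w n

lemma measurable_pathCons (x : S) : Measurable (pathCons x) :=
  measurable_pi_lambda _ fun n => by
    cases n with
    | zero => exact measurable_const
    | succ n => exact measurable_pi_apply n

variable (κ : Kernel S S)

lemma measurable_update_mul_lintegral (n : ℕ) {g : ℕ → S → ℝ≥0∞} (hg : ∀ i, Measurable (g i))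
    (i : ℕ) : Measurable
      (Function.update g n (fun s => g n s * ∫⁻ y, g (n + 1) y ∂(κ s)) i) := by
  by_cases h : i = n
  · subst h
    rw [Function.update_self]
    exact (hg _).mul (hg _).lintegral_kernel
  · rw [Function.update_of_ne h]
    exact hg i

variable [IsMarkovKernel κ]

lemma lintegral_markovLaw_succ (x : S) (n : ℕ)
    {F : ((i : Finset.Iic n) → S) × S → ℝ≥0∞} (hF : Measurable F) :
    ∫⁻ w, F (Preorder.frestrictLe n w, w (n + 1)) ∂(markovLaw κ x) =
      ∫⁻ w, ∫⁻ y, F (Preorder.frestrictLe n w, y) ∂(κ (w n)) ∂(markovLaw κ x) := by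
  set κ' : (n : ℕ) → Kernel ((i : Finset.Iic n) → S) S := fun n =>
    κ.comap (fun h => h ⟨n, Finset.mem_Iic.2 le_rfl⟩) (measurable_pi_apply _)
  have hT : markovLaw κ x = Kernel.trajMeasure (X := fun _ => S) (Measure.dirac x) κ' := by
    rw [Kernel.trajMeasure, Measure.map_dirac' (MeasurableEquiv.measurable _),
      Measure.dirac_bind (Kernel.measurable _)]
    rfl
  have hm := Kernel.map_frestrictLe_trajMeasure_compProd_eq_map_trajMeasure
    (X := fun _ => S) (μ₀ := Measure.dirac x) (κ := κ') (a := n)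
  have h2 : Measurable fun w : ℕ → S => (Preorder.frestrictLe (π := fun _ => S) n w, w (n + 1)) :=
    (Preorder.measurable_frestrictLe n).prodMk (measurable_pi_apply (n + 1))
  have hK : Measurable fun h : (i : Finset.Iic n) → S => ∫⁻ y, F (h, y) ∂(κ' n h) :=
    hF.lintegral_kernel_prod_right'
  rw [hT, ← lintegral_map hF h2, ← hm, Measure.lintegral_compProd hF]
  exact lintegral_map hK (Preorder.measurable_frestrictLe n)

/-- The last coordinate is integrated out and its factor absorbed into the preceding one. -/
lemma lintegral_prod_markovLaw_succ (x : S) (n : ℕ) {g : ℕ → S → ℝ≥0∞}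
    (hg : ∀ i, Measurable (g i)) :
    ∫⁻ w, ∏ i ∈ Finset.range (n + 2), g i (w i) ∂(markovLaw κ x) =
      ∫⁻ w, ∏ i ∈ Finset.range (n + 1),
        Function.update g n (fun s => g n s * ∫⁻ y, g (n + 1) y ∂(κ s)) i (w i)
        ∂(markovLaw κ x) := by
  have hF : Measurable fun q : ((i : Finset.Iic n) → S) × S =>
      (∏ i : Finset.Iic n, g i (q.1 i)) * g (n + 1) q.2 := by
    refine Measurable.fun_mul ?_ ((hg (n + 1)).comp measurable_snd)
    exact Finset.measurable_fun_prod _ fun i _ =>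
      (hg i).comp ((measurable_pi_apply i).comp measurable_fst)
  have hprod : ∀ w : ℕ → S, ∏ i : Finset.Iic n, g i (Preorder.frestrictLe (π := fun _ => S) n w i) =
      ∏ i ∈ Finset.range (n + 1), g i (w i) := fun w => by
    rw [Nat.range_succ_eq_Iic]
    exact Finset.prod_coe_sort (Finset.Iic n) (fun i => g i (w i))
  have h := lintegral_markovLaw_succ κ x n hF
  simp only [hprod] at h
  simp only [Finset.prod_range_succ _ (n + 1)]
  rw [h]
  refine lintegral_congr fun w => ?_
  rw [lintegral_const_mul _ (hg (n + 1)), Finset.prod_range_succ, Finset.prod_range_succ,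
    Function.update_self, mul_assoc]
  congr 1
  refine Finset.prod_congr rfl fun i hi => ?_
  rw [Function.update_of_ne (Finset.mem_range.1 hi).ne]

/-- First-step decomposition on product functions. The trajectory law is built by appending
coordinates at the end, so the induction strips the last coordinate, splits off the first step, and
restores the last coordinate for the chain started at `y`. -/
lemma lintegral_prod_markovLaw (x : S) (n : ℕ) {g : ℕ → S → ℝ≥0∞} (hg : ∀ i, Measurable (g i)) :
    ∫⁻ w, ∏ i ∈ Finset.range (n + 1), g i (w i) ∂(markovLaw κ x) =
      g 0 x * ∫⁻ y, ∫⁻ w, ∏ i ∈ Finset.range n, g (i + 1) (w i) ∂(markovLaw κ y) ∂(κ x) := by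
  have hzero : ∀ (f : S → ℝ≥0∞), Measurable f → ∀ y, ∫⁻ w, f (w 0) ∂(markovLaw κ y) = f y := by
    intro f hf y
    rw [← lintegral_map hf (measurable_pi_apply 0), markovLaw_map_zero, lintegral_dirac' _ hf]
  induction n generalizing g with
  | zero => simp [hzero _ (hg 0)]
  | succ n ih =>
    rw [lintegral_prod_markovLaw_succ κ x n hg, ih (measurable_update_mul_lintegral κ n hg)]
    cases n with
    | zero => simp [hzero _ (hg 1)]
    | succ n =>
      rw [Function.update_of_ne (by omega)]
      congr 1
      refine lintegral_congr fun y => ?_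
      rw [lintegral_prod_markovLaw_succ κ y n fun i => hg (i + 1)]
      refine lintegral_congr fun w => Finset.prod_congr rfl fun i _ => ?_
      by_cases h : i = n
      · subst h
        rw [Function.update_self, Function.update_self]
      · rw [Function.update_of_ne h, Function.update_of_ne (by omega)]

lemma ext_of_rect {μ ν : Measure (ℕ → S)} [IsFiniteMeasure μ]
    (h : ∀ (n : ℕ) (A : ℕ → Set S), (∀ i, MeasurableSet (A i)) →
      μ {w | ∀ i < n, w i ∈ A i} = ν {w | ∀ i < n, w i ∈ A i}) : μ = ν := by
  classical
  refine ext_of_generate_finite _ generateFrom_squareCylinders.symm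
    (isPiSystem_squareCylinders (fun _ => MeasurableSpace.isPiSystem_measurableSet)
      fun _ => MeasurableSet.univ) ?_ (by simpa using h 0 (fun _ => Set.univ))
  rintro _ ⟨s, t, ht, rfl⟩
  have ht' : ∀ i, MeasurableSet (t i) := fun i => ht i trivial
  obtain ⟨n, hn⟩ := s.exists_nat_subset_range
  have : (s : Set ℕ).pi t = {w | ∀ i < n, w i ∈ if i ∈ s then t i else Set.univ} := by
    ext w
    simp only [Set.mem_pi, Finset.mem_coe, Set.mem_ofPred_eq]
    constructor
    · intro H i _
      split_ifs with hi
      · exact H i hi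
      · trivial
    · intro H i hi
      simpa [hi] using H i (Finset.mem_range.1 (hn hi))
  rw [this]
  refine h n _ fun i => ?_
  split_ifs
  · exact ht' i
  · exact MeasurableSet.univ

lemma measurableSet_rect (n : ℕ) {A : ℕ → Set S} (hA : ∀ i, MeasurableSet (A i)) :
    MeasurableSet {w : ℕ → S | ∀ i < n, w i ∈ A i} := by
  have : {w : ℕ → S | ∀ i < n, w i ∈ A i} = ⋂ i, ⋂ (_ : i < n), (fun w => w i) ⁻¹' A i := by
    ext w
    simp
  rw [this]
  exact MeasurableSet.iInter fun i => MeasurableSet.iInter fun _ => measurable_pi_apply i (hA i)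

lemma lintegral_rect (μ : Measure (ℕ → S)) (n : ℕ) {A : ℕ → Set S}
    (hA : ∀ i, MeasurableSet (A i)) :
    ∫⁻ w, ∏ i ∈ Finset.range n, (A i).indicator (fun _ => (1 : ℝ≥0∞)) (w i) ∂μ =
      μ {w | ∀ i < n, w i ∈ A i} := by
  rw [← lintegral_indicator_const_one μ (measurableSet_rect n hA)]
  refine lintegral_congr fun w => ?_
  by_cases h : w ∈ {w : ℕ → S | ∀ i < n, w i ∈ A i}
  · rw [Set.indicator_of_mem h]
    exact Finset.prod_eq_one fun i hi => Set.indicator_of_mem (h i (Finset.mem_range.1 hi)) _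
  · rw [Set.indicator_of_notMem h]
    rw [Set.mem_ofPred_eq] at h
    push Not at h
    obtain ⟨i, hi, hi'⟩ := h
    exact Finset.prod_eq_zero (Finset.mem_range.2 hi) (Set.indicator_of_notMem hi' _)

/-- First-step decomposition of the law of a Markov chain. -/
lemma markovLaw_eq_map_pathCons (x : S) :
    markovLaw κ x = ((κ x).bind (markovLaw κ)).map (pathCons x) := by
  refine ext_of_rect fun n A hA => ?_
  rw [Measure.map_apply (measurable_pathCons x) (measurableSet_rect n hA),
    Measure.bind_apply (measurable_pathCons x (measurableSet_rect n hA))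
      (Kernel.aemeasurable _)]
  cases n with
  | zero => simp
  | succ n =>
    rw [← lintegral_rect _ _ hA, lintegral_prod_markovLaw κ x n
      fun i => measurable_const.indicator (hA i)]
    simp only [lintegral_rect _ n (A := fun i => A (i + 1)) fun i => hA (i + 1)]
    rw [← lintegral_const_mul _ ((markovLaw κ).measurable_coe
      (measurableSet_rect n fun i => hA (i + 1)))]
    refine lintegral_congr fun y => ?_
    by_cases hx : x ∈ A 0
    · rw [Set.indicator_of_mem hx, one_mul]
      congr 1
      ext w
      simp only [Set.mem_ofPred_eq, Set.mem_preimage]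
      constructor
      · intro H i hi
        cases i with
        | zero => exact hx
        | succ i => exact H i (by omega)
      · intro H i hi
        exact H (i + 1) (by omega)
    · rw [Set.indicator_of_notMem hx, zero_mul]
      symm
      refine measure_mono_null ?_ measure_empty
      intro w hw
      exact hx (hw 0 (Nat.succ_pos n))

lemma markovLaw_apply (x : S) {E : Set (ℕ → S)} (hE : MeasurableSet E) :
    markovLaw κ x E = ∫⁻ y, markovLaw κ y (pathCons x ⁻¹' E) ∂(κ x) := by
  conv_lhs => rw [markovLaw_eq_map_pathCons κ x]
  rw [Measure.map_apply (measurable_pathCons x) hE,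
    Measure.bind_apply (measurable_pathCons x hE) (Kernel.aemeasurable _)]

lemma lintegral_markovLaw (x : S) {F : (ℕ → S) → ℝ≥0∞} (hF : Measurable F) :
    ∫⁻ w, F w ∂(markovLaw κ x) = ∫⁻ y, ∫⁻ w, F (pathCons x w) ∂(markovLaw κ y) ∂(κ x) := by
  conv_lhs => rw [markovLaw_eq_map_pathCons κ x]
  rw [lintegral_map hF (measurable_pathCons x)]
  exact Measure.lintegral_bind (Kernel.aemeasurable _)
    (hF.comp (measurable_pathCons x)).aemeasurable

lemma measurable_pathShift : Measurable fun (w : ℕ → S) (n : ℕ) => w (n + 1) :=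
  measurable_pi_lambda _ fun n => measurable_pi_apply (n + 1)

lemma measurePreserving_pathShift {Q : Measure S} (hQ : Kernel.Invariant κ Q) :
    MeasurePreserving (fun (w : ℕ → S) (n : ℕ) => w (n + 1)) (Q.bind (markovLaw κ))
      (Q.bind (markovLaw κ)) := by
  refine ⟨measurable_pathShift, Measure.ext fun E hE => ?_⟩
  have hE' := measurable_pathShift hE
  rw [Measure.map_apply measurable_pathShift hE, Measure.bind_apply hE' (Kernel.aemeasurable _),
    Measure.bind_apply hE (Kernel.aemeasurable _)]
  simp only [markovLaw_apply κ _ hE']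
  conv_rhs => rw [← hQ.def]
  rw [Measure.lintegral_bind (Kernel.aemeasurable _)
    ((markovLaw κ).measurable_coe hE).aemeasurable]
  rfl

/-- A stationary Markov chain is ergodic when the probabilities of shift-invariant events do not
depend on the initial state. -/
lemma ergodic_of_markovLaw_const {Q : Measure S} [IsProbabilityMeasure Q]
    (hQ : Kernel.Invariant κ Q)
    (hconst : ∀ E : Set (ℕ → S), MeasurableSet E →
      (fun (w : ℕ → S) (n : ℕ) => w (n + 1)) ⁻¹' E = E →
      ∃ c : ℝ≥0∞, ∀ᵐ x ∂Q, markovLaw κ x E = c) :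
    Ergodic (fun (w : ℕ → S) (n : ℕ) => w (n + 1)) (Q.bind (markovLaw κ)) := by
  have hprob : IsProbabilityMeasure (Q.bind (markovLaw κ)) := inferInstance
  refine { measurePreserving_pathShift κ hQ with aeconst_set := fun E hE hinv => ?_ }
  obtain ⟨c, hc⟩ := hconst E hE hinv
  have hcons : ∀ (x : S) (w : ℕ → S), pathCons x w ∈ E ↔ w ∈ E := fun x w => by
    conv_lhs => rw [← hinv]
    rfl
  -- An invariant event is unchanged when a state is prepended, so the first-step decomposition
  -- factors it out of every cylinder. Invariance of `Q` guarantees that the exceptional set of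
  -- initial states is also avoided after one step.
  have hrect : ∀ (n : ℕ) (A : ℕ → Set S), (∀ i, MeasurableSet (A i)) →
      ∀ᵐ x ∂Q, markovLaw κ x ({w | ∀ i < n, w i ∈ A i} ∩ E) =
        c * markovLaw κ x {w | ∀ i < n, w i ∈ A i} := by
    intro n
    induction n with
    | zero =>
      intro A _
      filter_upwards [hc] with x hx
      simp [hx]
    | succ n ih =>
      intro A hA
      have h := ih (fun i => A (i + 1)) fun i => hA (i + 1)
      rw [← hQ.def] at h
      filter_upwards [Measure.ae_ae_of_ae_bind (Kernel.aemeasurable _) h] with x hx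
      have hm := measurableSet_rect (n + 1) hA
      have hm' := measurableSet_rect n fun i => hA (i + 1)
      rw [markovLaw_apply κ x (hm.inter hE), markovLaw_apply κ x hm]
      by_cases hx0 : x ∈ A 0
      · have hpre : pathCons x ⁻¹' {w | ∀ i < n + 1, w i ∈ A i} =
            {w | ∀ i < n, w i ∈ A (i + 1)} := by
          ext w
          simp only [Set.mem_ofPred_eq, Set.mem_preimage]
          constructor
          · intro H i hi
            exact H (i + 1) (by omega)
          · intro H i hi
            cases i with
            | zero => exact hx0
            | succ i => exact H i (by omega)
        have hpreE : pathCons x ⁻¹' E = E := Set.ext fun w => hcons x w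
        rw [Set.preimage_inter, hpre, hpreE,
          ← lintegral_const_mul _ ((markovLaw κ).measurable_coe hm')]
        exact lintegral_congr_ae hx
      · have hpre : pathCons x ⁻¹' {w | ∀ i < n + 1, w i ∈ A i} = ∅ := by
          ext w
          simp only [Set.mem_ofPred_eq, Set.mem_preimage, Set.mem_empty_iff_false, iff_false]
          exact fun H => hx0 (H 0 (Nat.succ_pos n))
        simp only [Set.preimage_inter, hpre, Set.empty_inter, measure_empty, lintegral_zero, mul_zero]
  have hcE : (Q.bind (markovLaw κ)).restrict E = c • Q.bind (markovLaw κ) := by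
    refine ext_of_rect fun n A hA => ?_
    have hm := measurableSet_rect n hA
    rw [Measure.restrict_apply hm, Measure.bind_apply (hm.inter hE) (Kernel.aemeasurable _),
      lintegral_congr_ae (hrect n A hA), Measure.smul_apply,
      Measure.bind_apply hm (Kernel.aemeasurable _),
      lintegral_const_mul _ ((markovLaw κ).measurable_coe hm), smul_eq_mul]
  have huniv := congrArg (· Set.univ) hcE
  simp only [Measure.restrict_apply_univ, Measure.smul_apply, measure_univ, smul_eq_mul,
    mul_one] at huniv
  -- Evaluating on the complement gives `0 = c * μ(Eᶜ)` for the path law `μ`, while the whole space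
  -- gave `μ(E) = c`. So `E` is trivial.
  have hcompl := congrArg (· Eᶜ) hcE
  simp only [Measure.restrict_apply hE.compl, Set.compl_inter_self, measure_empty,
    Measure.smul_apply, smul_eq_mul] at hcompl
  rw [eventuallyConst_set]
  rcases mul_eq_zero.1 hcompl.symm with h | h
  · right
    have h0 : Q.bind (markovLaw κ) E = 0 := huniv.trans h
    filter_upwards [measure_eq_zero_iff_ae_notMem.1 h0] with w hw using hw
  · left
    filter_upwards [measure_eq_zero_iff_ae_notMem.1 h] with w hw using not_not.1 hw

end Markov

/-! ### The environment process and transfer operators -/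

/-- The weight of the transition probabilities themselves. -/
def stepWeight {d : ℕ} (π : PMF (Site d)) (z : Site d) : ℝ≥0∞ := π z

lemma measurable_stepWeight {d : ℕ} (z : Site d) :
    Measurable fun π : PMF (Site d) => stepWeight π z :=
  measurable_pmf_apply z

lemma lintegral_walkKernel {d : ℕ} (ω : Env d) (x : Site d) (f : Site d → ℝ≥0∞) :
    ∫⁻ y, f y ∂(walkKernel ω x) = ∑' z, ω x z * f (x + z) := by
  rw [lintegral_countable', ← (Equiv.addLeft x).tsum_eq]
  refine tsum_congr fun z => ?_
  rw [walkKernel_singleton, mul_comm]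
  simp [jump]

lemma envKernel_eq_map {d : ℕ} (ω : Env d) :
    envKernel d ω = (walkKernel ω 0).map fun z => shift z ω := by
  refine Measure.ext fun A hA => ?_
  rw [envKernel_apply ω hA, Measure.map_apply Measurable.of_discrete hA,
    ← markovLaw_map_one (walkKernel ω) 0,
    Measure.map_apply (measurable_pi_apply 1) MeasurableSet.of_discrete]
  rfl

lemma lintegral_envKernel {d : ℕ} (ω : Env d) {f : Env d → ℝ≥0∞} (hf : Measurable f) :
    ∫⁻ ω', f ω' ∂(envKernel d ω) = op stepWeight f ω := by
  rw [envKernel_eq_map, lintegral_map hf Measurable.of_discrete, lintegral_walkKernel, op_apply]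
  simp [stepWeight]

lemma bind_envKernel {d : ℕ} (μ : Measure (Env d)) : μ.bind (envKernel d) = push stepWeight μ := by
  refine Measure.ext_of_lintegral _ fun f hf => ?_
  rw [Measure.lintegral_bind (Kernel.aemeasurable _) hf.aemeasurable,
    lintegral_push measurable_stepWeight μ hf]
  exact lintegral_congr fun ω => lintegral_envKernel ω hf

/-- The starting point is absorbed into the environment: walking from `x` in `ω` is walking from `0`
in `shift x ω`. -/
lemma lintegral_markovLaw_walkKernel {d : ℕ} (ω : Env d) (x : Site d) (n : ℕ)
    (f : Env d → ℝ≥0∞) :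
    ∫⁻ X, f (shift (X n) ω) ∂(markovLaw (walkKernel ω) x) = (op stepWeight ^ n) f (shift x ω) := by
  have hm : ∀ m : ℕ, Measurable fun X : ℕ → Site d => f (shift (X m) ω) := fun m =>
    (Measurable.of_discrete (f := fun z : Site d => f (shift z ω))).comp (measurable_pi_apply m)
  induction n generalizing x with
  | zero =>
    rw [lintegral_markovLaw _ x (hm 0)]
    simp [pathCons]
  | succ n ih =>
    rw [lintegral_markovLaw _ x (hm (n + 1))]
    simp only [pathCons, ih]
    rw [lintegral_walkKernel, pow_succ']
    change _ = op stepWeight ((op stepWeight ^ n) f) (shift x ω)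
    rw [op_apply]
    simp [shift_shift, stepWeight, shift]

lemma envLaw_apply {d : ℕ} (P : Measure (Env d)) [IsProbabilityMeasure P] (n : ℕ)
    {A : Set (Env d)} (hA : MeasurableSet A) :
    envLaw P n A = ∫⁻ ω, (op stepWeight ^ n) (A.indicator fun _ => 1) ω ∂P := by
  rw [envLaw, annealedLaw, Measure.map_apply (measurable_seenEnv n) hA,
    Measure.compProd_apply (measurable_seenEnv n hA)]
  refine lintegral_congr fun ω => ?_
  have h := lintegral_markovLaw_walkKernel ω 0 n (A.indicator fun _ => 1)
  rw [shift_zero] at h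
  rw [← h, ← lintegral_indicator_const_one _ (measurable_prodMk_left (measurable_seenEnv n hA))]
  rfl

/-! ### ### Agreement of split and true step weights -/

lemma op_pow_congr_of_good {d : ℕ} {G : Set (PMF (Site d))} {v w : PMF (Site d) → Site d → ℝ≥0∞}
    (h : ∀ π ∈ G, ∀ z, v π z = w π z) (n : ℕ) (f : Env d → ℝ≥0∞) {ω : Env d}
    (hω : ∀ x, ω x ∈ G) : (op v ^ n) f ω = (op w ^ n) f ω := by
  induction n generalizing ω with
  | zero => rfl
  | succ n ih =>
    rw [pow_succ', pow_succ']
    change op v ((op v ^ n) f) ω = op w ((op w ^ n) f) ω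
    rw [op_apply, op_apply]
    exact tsum_congr fun z => by rw [h _ (hω 0), ih (ω := shift z ω) fun x => hω (x + z)]

lemma push_congr_of_good {d : ℕ} {G : Set (PMF (Site d))} {v w : PMF (Site d) → Site d → ℝ≥0∞}
    (hv : ∀ z, Measurable fun π => v π z) (hw : ∀ z, Measurable fun π => w π z)
    (h : ∀ π ∈ G, ∀ z, v π z = w π z) {μ : Measure (Env d)} (hμ : ∀ᵐ ω ∂μ, ∀ x, ω x ∈ G) :
    push v μ = push w μ := by
  refine Measure.ext_of_lintegral _ fun f hf => ?_
  rw [lintegral_push hv μ hf, lintegral_push hw μ hf]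
  refine lintegral_congr_ae ?_
  filter_upwards [hμ] with ω hω
  simpa using op_pow_congr_of_good h 1 f hω

/-- An event about one site lives on some half-space and there are countably many sites, so absolute
continuity on half-spaces suffices. -/
lemma good_of_upperAbsCont {d : ℕ} {u : Fin d → ℝ} {η : ℝ} (hη : 0 < η) {P μ : Measure (Env d)}
    (hP : IsIIDEnvironment P) {G : Set (PMF (Site d))} (hG : MeasurableSet G)
    (hPG : ∀ᵐ ω ∂P, ω 0 ∈ G) (hμ : ∀ N : ℕ, UpperAbsCont u (-(N * η)) μ P) :
    ∀ᵐ ω ∂μ, ∀ x, ω x ∈ G := by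
  refine ae_all_iff.2 fun x => ?_
  obtain ⟨N, hN⟩ := exists_nat_neg_mul_le hη (dot x u)
  refine hμ N ((fun ω : Env d => ω x) ⁻¹' Gᶜ) (measurable_pi_apply x hG.compl) ((isUpper_eval_preimage u x Gᶜ).mono hN) ?_
  have h : ∀ᵐ ω ∂(P.map (shift x)), ω 0 ∈ G := by
    rw [hP.map_shift x]
    exact hPG
  have h' := ae_of_ae_map (measurable_shift_const x).aemeasurable h
  simp only [shift, zero_add] at h'
  exact h'

/-! ### Ergodicity of the stationary environment process -/

/-- By the layer-cake formula the integrals are integrals of level-set masses, dominated by those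
under `κ`. -/
lemma tendsto_lintegral_of_setwise {α : Type*} [MeasurableSpace α] {ν : ℕ → Measure α}
    {ρ κ : Measure α} [IsFiniteMeasure κ] (hle : ∀ n B, MeasurableSet B → ν n B ≤ κ B)
    (hν : ∀ B, MeasurableSet B → Tendsto (fun n => ν n B) atTop (𝓝 (ρ B)))
    {f : α → ℝ≥0∞} (hf : Measurable f) (hf1 : ∀ a, f a ≤ 1) :
    Tendsto (fun n => ∫⁻ a, f a ∂(ν n)) atTop (𝓝 (∫⁻ a, f a ∂ρ)) := by
  have hlayer : ∀ μ : Measure α, ∫⁻ a, f a ∂μ =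
      ∫⁻ t in Set.Ioi (0 : ℝ), μ {a | t ≤ (f a).toReal} := fun μ => by
    rw [← lintegral_eq_lintegral_meas_le μ (Eventually.of_forall fun _ => ENNReal.toReal_nonneg)
      hf.ennreal_toReal.aemeasurable]
    exact lintegral_congr fun a =>
      (ENNReal.ofReal_toReal (ne_top_of_le_ne_top ENNReal.one_ne_top (hf1 a))).symm
  have hms : ∀ t : ℝ, MeasurableSet {a | t ≤ (f a).toReal} := fun t =>
    measurableSet_le measurable_const hf.ennreal_toReal
  simp only [hlayer]
  refine tendsto_lintegral_of_dominated_convergence (fun t => κ {a | t ≤ (f a).toReal})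
    (fun n => ?_) (fun n => Eventually.of_forall fun t => hle n _ (hms t)) ?_
    (Eventually.of_forall fun t => hν _ (hms t))
  · exact Antitone.measurable fun s t hst => measure_mono fun a (ha : t ≤ _) => hst.trans ha
  · rw [← hlayer]
    refine ne_top_of_le_ne_top (measure_ne_top κ Set.univ) ?_
    calc ∫⁻ a, f a ∂κ ≤ ∫⁻ _, 1 ∂κ := lintegral_mono hf1
      _ = κ Set.univ := by simp

namespace Splitting

variable {d : ℕ} {u : Fin d → ℝ} {η : ℝ} {ε : ℝ≥0∞} {S : Splitting u η ε}
  {P Q : Measure (Env d)}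

lemma push_iterate_restrict_le (w : PMF (Site d) → Site d → ℝ≥0∞)
    (hw : ∀ z, Measurable fun π => w π z) (hQ : push w Q = Q) (A : Set (Env d)) (n : ℕ)
    {B : Set (Env d)} (hB : MeasurableSet B) :
    (push w)^[n] (Q.restrict A) B ≤ Q B := by
  have hm : Measurable (B.indicator fun _ => (1 : ℝ≥0∞)) := measurable_const.indicator hB
  calc (push w)^[n] (Q.restrict A) B
      = ∫⁻ ω, (op w ^ n) (B.indicator fun _ => 1) ω ∂(Q.restrict A) := by
        rw [← lintegral_push_iterate hw _ n hm, lintegral_indicator_const_one _ hB]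
    _ ≤ ∫⁻ ω, (op w ^ n) (B.indicator fun _ => 1) ω ∂Q := setLIntegral_le_lintegral _ _
    _ = Q B := by
        rw [← lintegral_push_iterate hw _ n hm, Function.iterate_fixed hQ,
          lintegral_indicator_const_one _ hB]

variable [IsProbabilityMeasure P] [IsProbabilityMeasure Q]

/-- The stationary environment process is mixing. -/
lemma IsStationaryLaw.tendsto_setwise (hP : IsIIDEnvironment P) (hQ : S.IsStationaryLaw P Q)
    (A : Set (Env d)) {B : Set (Env d)} (hB : MeasurableSet B) :
    Tendsto (fun n => (push S.full)^[n] (Q.restrict A) B) atTop (𝓝 (Q A * Q B)) := by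
  have hmass : ∀ n, (push S.full)^[n] (Q.restrict A) Set.univ = Q A := fun n => by
    rw [S.measure_push_full_iterate_univ, Measure.restrict_apply_univ]
  -- Half-space events are covered by convergence from the initial law `Q.restrict A`. The extension
  -- to all events is possible because invariance of `Q` bounds every iterate by `Q`, which
  -- dominates countable unions.
  induction B, hB using MeasurableSpace.induction_on_inter (generateFrom_upperEvents u S.pos_η)
    (isPiSystem_upperEvents u S.pos_η) with
  | empty => simp
  | basic B hB =>
    obtain ⟨hBm, N, hN⟩ := hB
    have hm : Measurable (B.indicator fun _ => (1 : ℝ≥0∞)) := measurable_const.indicator hBm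
    have h := hQ.tendsto hP (Q.restrict A) N
      (fun C hC hup h0 => le_antisymm ((Measure.restrict_apply_le _ _).trans_eq
        (hQ.upperAbsCont hP N C hC hup h0)) zero_le) (indicator_one_le B) hm
        hN.dependsOn_indicator
    rw [Measure.restrict_apply_univ, lintegral_indicator_const_one _ hBm] at h
    refine h.congr fun n => ?_
    rw [← lintegral_push_iterate S.measurable_full _ _ hm, lintegral_indicator_const_one _ hBm]
  | compl B hB ih =>
    have h := ENNReal.Tendsto.sub (tendsto_const_nhds (x := Q A)) ih
      (Or.inl (measure_ne_top _ _))
    rw [measure_compl hB (measure_ne_top _ _), measure_univ, ENNReal.mul_sub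
      (fun _ _ => measure_ne_top _ _), mul_one]
    refine h.congr fun n => ?_
    rw [measure_compl hB (ne_top_of_le_ne_top (measure_ne_top Q B)
      (push_iterate_restrict_le _ S.measurable_full (hQ.push_full hP) A n hB)), hmass]
  | iUnion f hd hf ih =>
    rw [measure_iUnion hd hf, ← ENNReal.tsum_mul_left]
    have h := tendsto_tsum_of_dominated (B := fun i => Q (f i))
      (by rw [← measure_iUnion hd hf]; exact measure_ne_top _ _)
      (fun n i => push_iterate_restrict_le _ S.measurable_full (hQ.push_full hP) A n (hf i)) ih
    exact h.congr fun n => (measure_iUnion hd hf).symm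

/-- The integral of `h` over `A` equals that of `(op S.full ^ n) h`, which mixing sends to `Q A`
times the mean of `h`. As `A` is arbitrary, `h` is constant. -/
lemma IsStationaryLaw.ae_eq_const_of_harmonic (hP : IsIIDEnvironment P)
    (hQ : S.IsStationaryLaw P Q) {h : Env d → ℝ≥0∞} (hm : Measurable h) (h1 : ∀ ω, h ω ≤ 1)
    (hh : ∀ n, (op S.full ^ n) h =ᵐ[Q] h) : ∃ c : ℝ≥0∞, ∀ᵐ ω ∂Q, h ω = c := by
  refine ⟨∫⁻ ω, h ω ∂Q, ?_⟩
  refine ae_eq_of_forall_setLIntegral_eq_of_sigmaFinite hm measurable_const fun A hA _ => ?_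
  have hlim := tendsto_lintegral_of_setwise (ρ := Q A • Q) (κ := Q)
    (fun n B hB => push_iterate_restrict_le _ S.measurable_full (hQ.push_full hP) A n hB)
    (fun B hB => by simpa using hQ.tendsto_setwise hP A hB) hm h1
  rw [lintegral_smul_measure, smul_eq_mul] at hlim
  rw [lintegral_const, Measure.restrict_apply_univ, mul_comm]
  refine tendsto_nhds_unique (tendsto_const_nhds.congr fun n => ?_) hlim
  rw [lintegral_push_iterate S.measurable_full _ _ hm]
  exact (lintegral_congr_ae (ae_restrict_of_ae (hh n))).symm

/-- The probability of a shift-invariant event, as a function of the initial environment, is bounded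
and harmonic, hence constant. -/
lemma IsStationaryLaw.ergodicEnvChain (hP : IsIIDEnvironment P)
    (hQ : S.IsStationaryLaw P Q) {G : Set (PMF (Site d))}
    (hG : ∀ π ∈ G, ∀ z, S.full π z = stepWeight π z) (hQG : ∀ᵐ ω ∂Q, ∀ x, ω x ∈ G)
    (hinv : Kernel.Invariant (envKernel d) Q) : ErgodicEnvChain Q := by
  refine ergodic_of_markovLaw_const _ hinv fun E hE hEinv => ?_
  have hm : Measurable fun ω => markovLaw (envKernel d) ω E := (markovLaw _).measurable_coe hE
  refine hQ.ae_eq_const_of_harmonic hP hm (fun ω => prob_le_one) fun n => ?_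
  have hpre : ∀ ω, pathCons ω ⁻¹' E = E := fun ω => by
    conv_lhs => rw [← hEinv]
    rfl
  have hop : op stepWeight (fun ω => markovLaw (envKernel d) ω E) =
      fun ω => markovLaw (envKernel d) ω E := by
    funext ω
    rw [← lintegral_envKernel ω hm, markovLaw_apply _ ω hE, hpre]
  have hpow : (op stepWeight ^ n) (fun ω => markovLaw (envKernel d) ω E) =
      fun ω => markovLaw (envKernel d) ω E := by
    induction n with
    | zero => rfl
    | succ n ih =>
      rw [pow_succ]
      change (op stepWeight ^ n) (op stepWeight _) = _
      rw [hop, ih]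
  filter_upwards [hQG] with ω hω
  rw [op_pow_congr_of_good hG n _ hω, hpow]

end Splitting

/-! ### Existence of splittings -/

/-- The mass of the jumps that advance by at least `η`. -/
noncomputable def advanceMass {d : ℕ} (u : Fin d → ℝ) (η : ℝ) (π : PMF (Site d)) : ℝ≥0∞ :=
  ∑' z, {z : Site d | η ≤ dot z u}.indicator π z

/-- The step laws that do not move against `u` and advance by `η` with probability at least
`ε`. -/
def goodLaws {d : ℕ} (u : Fin d → ℝ) (η : ℝ) (ε : ℝ≥0∞) : Set (PMF (Site d)) :=
  {π | (∀ z, dot z u < 0 → π z = 0) ∧ ε ≤ advanceMass u η π}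

lemma measurable_advanceMass {d : ℕ} (u : Fin d → ℝ) (η : ℝ) :
    Measurable (advanceMass (d := d) u η) := by
  refine Measurable.tsum fun z => ?_
  by_cases hz : z ∈ {z : Site d | η ≤ dot z u}
  · simp only [Set.indicator_of_mem hz]
    exact measurable_pmf_apply z
  · simp only [Set.indicator_of_notMem hz]
    exact measurable_const

lemma advanceMass_le_one {d : ℕ} (u : Fin d → ℝ) (η : ℝ) (π : PMF (Site d)) :
    advanceMass u η π ≤ 1 :=
  (ENNReal.tsum_le_tsum fun z => Set.indicator_le_self' (fun _ _ => zero_le) z).trans_eq π.tsum_coe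

lemma measurableSet_goodLaws {d : ℕ} (u : Fin d → ℝ) (η : ℝ) (ε : ℝ≥0∞) :
    MeasurableSet (goodLaws (d := d) u η ε) := by
  refine MeasurableSet.inter ?_ (measurableSet_le measurable_const (measurable_advanceMass u η))
  have : {π : PMF (Site d) | ∀ z, dot z u < 0 → π z = 0} =
      ⋂ z, ⋂ (_ : dot z u < 0), {π | π z = 0} := by
    ext π
    simp
  change MeasurableSet {π : PMF (Site d) | ∀ z, dot z u < 0 → π z = 0}
  rw [this]
  exact MeasurableSet.iInter fun z => MeasurableSet.iInter fun _ =>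
    measurableSet_eq_fun (measurable_pmf_apply z) measurable_const

/-- Bad step laws are replaced by a fixed good one, so the identities hold for every `π`. The marked
part is the restriction to advancing jumps, scaled by `ε / advanceMass ≤ 1` to have mass exactly
`ε`. -/
lemma exists_splitting {d : ℕ} {u : Fin d → ℝ} {η : ℝ} {ε : ℝ≥0∞} (hη : 0 < η) (hε : 0 < ε)
    (h : (goodLaws (d := d) u η ε).Nonempty) :
    ∃ S : Splitting (d := d) u η ε, ∀ π ∈ goodLaws u η ε, ∀ z, S.full π z = stepWeight π z := by
  classical
  obtain ⟨π₀, h₀⟩ := h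
  set q : PMF (Site d) → PMF (Site d) := fun π => if π ∈ goodLaws u η ε then π else π₀
  have hq : ∀ π, q π ∈ goodLaws u η ε := fun π => by
    by_cases hπ : π ∈ goodLaws u η ε
    · simp [q, hπ]
    · simpa [q, hπ] using h₀
  have hqm : Measurable q :=
    Measurable.ite (measurableSet_goodLaws u η ε) measurable_id measurable_const
  have hqz : ∀ z, Measurable fun π => q π z := fun z => (measurable_pmf_apply z).comp hqm
  have hm0 : ∀ π, advanceMass u η (q π) ≠ 0 := fun π => (hε.trans_le (hq π).2).ne'
  have hmt : ∀ π, advanceMass u η (q π) ≠ ∞ := fun π =>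
    ne_top_of_le_ne_top ENNReal.one_ne_top (advanceMass_le_one u η _)
  set m : PMF (Site d) → Site d → ℝ≥0∞ := fun π z =>
    ε / advanceMass u η (q π) * {z : Site d | η ≤ dot z u}.indicator (q π) z
  have hmm : ∀ z, Measurable fun π => m π z := by
    intro z
    refine (measurable_const.div ((measurable_advanceMass u η).comp hqm)).mul ?_
    by_cases hz : z ∈ {z : Site d | η ≤ dot z u}
    · simp only [Set.indicator_of_mem hz]
      exact hqz z
    · simp only [Set.indicator_of_notMem hz]
      exact measurable_const
  have hmsum : ∀ π, ∑' z, m π z = ε := fun π => by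
    rw [ENNReal.tsum_mul_left]
    exact ENNReal.div_mul_cancel (hm0 π) (hmt π)
  have hmle : ∀ π z, m π z ≤ q π z := fun π z => by
    calc m π z ≤ 1 * q π z :=
          mul_le_mul' (ENNReal.div_le_of_le_mul (by simpa using (hq π).2))
            (Set.indicator_le_self' (fun _ _ => zero_le) z)
      _ = q π z := one_mul _
  have hε1 : ε ≤ 1 := h₀.2.trans (advanceMass_le_one u η π₀)
  let S : Splitting (d := d) u η ε :=
    { unm := fun π z => q π z - m π z
      mrk := m
      measurable_unm := fun z => (hqz z).sub (hmm z)
      measurable_mrk := hmm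
      le_of_unm_ne_zero := fun π z hne => by
        by_contra hlt
        exact hne (by simp [(hq π).1 z (not_le.1 hlt)])
      le_of_mrk_ne_zero := fun π z hne => by
        by_contra hlt
        have hz : z ∉ {z : Site d | η ≤ dot z u} := hlt
        exact hne (by simp only [m, Set.indicator_of_notMem hz, mul_zero])
      tsum_unm := fun π => by
        refine ENNReal.eq_sub_of_add_eq (ne_top_of_le_ne_top ENNReal.one_ne_top hε1) ?_
        conv_lhs => rw [← hmsum π, ← ENNReal.tsum_add]
        simp only [tsub_add_cancel_of_le (hmle π _), (q π).tsum_coe]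
      tsum_mrk := hmsum
      pos_η := hη
      pos_ε := hε
      ε_le_one := hε1 }
  refine ⟨S, fun π hπ z => ?_⟩
  change q π z - m π z + m π z = π z
  rw [tsub_add_cancel_of_le (hmle π z)]
  simp [q, hπ]

lemma l1norm_nonneg {d : ℕ} (z : Site d) : 0 ≤ l1norm z :=
  Finset.sum_nonneg fun _ _ => abs_nonneg _

lemma exists_dot_le {d : ℕ} (u : Fin d → ℝ) :
    ∃ C : ℝ, 0 < C ∧ ∀ z : Site d, dot z u ≤ C * l1norm z := by
  refine ⟨∑ i, |u i| + 1, by positivity, fun z => ?_⟩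
  rw [dot, l1norm, Finset.mul_sum]
  refine Finset.sum_le_sum fun i _ => (le_abs_self _).trans ?_
  rw [abs_mul, mul_comm]
  refine mul_le_mul_of_nonneg_right ?_ (abs_nonneg _)
  have := Finset.single_le_sum (f := fun i => |u i|) (fun i _ => abs_nonneg _) (Finset.mem_univ i)
  linarith

/-- One term for each of the ranges `x < η`, `η ≤ x ≤ B` and `x > B`. In the last, `x = x ^ (1 - p)
* x ^ p` with `1 - p < 0`. Averaging over a step law bounds the drift by the advancing mass. -/
lemma le_threshold {x y C B η p : ℝ} (hp : 1 < p) (hB : 0 < B) (hη : 0 < η) (hC : 0 < C)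
    (hy : 0 ≤ y) (hxy : x ≤ C * y) :
    x ≤ η + B * (if η ≤ x then 1 else 0) + B ^ (1 - p) * C ^ p * y ^ p := by
  have h3 : 0 ≤ B ^ (1 - p) * C ^ p * y ^ p := by positivity
  split_ifs with h
  · rcases le_or_gt x B with hxB | hxB
    · linarith
    · have hx : 0 < x := hB.trans hxB
      have : x ≤ B ^ (1 - p) * C ^ p * y ^ p := by
        calc x = x ^ (1 - p) * x ^ p := by
              rw [← Real.rpow_add hx]
              simp
          _ ≤ B ^ (1 - p) * (C * y) ^ p := by
              refine mul_le_mul ?_ (Real.rpow_le_rpow hx.le hxy (by linarith)) (by positivity)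
                (by positivity)
              exact Real.rpow_le_rpow_of_nonpos hB hxB.le (by linarith)
          _ = _ := by rw [Real.mul_rpow hC.le hy, mul_assoc]
      linarith
  · linarith

/-- A positive drift and a moment bound force a fixed advance with a fixed probability. -/
lemma exists_le_advanceMass {d : ℕ} (u : Fin d → ℝ) {p δ M : ℝ} (hp : 1 < p) (hδ : 0 < δ)
    (hM : 0 < M) :
    ∃ ε : ℝ≥0∞, 0 < ε ∧ ∀ π : PMF (Site d), δ ≤ ∑' z : Site d, dot z u * (π z).toReal →
      ∑' z : Site d, ENNReal.ofReal (l1norm z ^ p) * π z ≤ ENNReal.ofReal (M ^ p) →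
      ε ≤ advanceMass u (δ / 2) π := by
  obtain ⟨C, hC, hCz⟩ := exists_dot_le u
  have hlim : Tendsto (fun B : ℝ => B ^ (1 - p) * C ^ p * M ^ p) atTop (𝓝 0) := by
    have := (tendsto_rpow_neg_atTop (y := p - 1) (by linarith)).mul_const (C ^ p * M ^ p)
    simpa [mul_assoc] using this
  -- Of the drift `δ`, jumps below `δ / 2` account for at most half and the tail beyond `B` for at
  -- most `δ / 4`. The remaining `δ / 4` is at most `B` times the advancing mass, whence the choice
  -- `ε = δ / (4 B)`.
  obtain ⟨B, hB, hBpos⟩ := ((hlim.eventually (gt_mem_nhds (show 0 < δ / 4 by linarith))).and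
    (eventually_gt_atTop 0)).exists
  refine ⟨ENNReal.ofReal (δ / 4 / B), by simp; positivity, fun π hπ hmom => ?_⟩
  set a : Site d → ℝ := fun z => (π z).toReal
  have ha : ∀ z, 0 ≤ a z := fun z => ENNReal.toReal_nonneg
  have hasum : HasSum a 1 := by
    have := ENNReal.hasSum_toReal (f := π) (by rw [π.tsum_coe]; exact ENNReal.one_ne_top)
    rwa [← ENNReal.tsum_toReal_eq fun z => π.apply_ne_top z, π.tsum_coe, ENNReal.toReal_one] at this
  have hind : ∀ z, ({z : Site d | δ / 2 ≤ dot z u}.indicator π z).toReal =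
      (if δ / 2 ≤ dot z u then 1 else 0) * a z := fun z => by
    by_cases hz : δ / 2 ≤ dot z u
    · simp [hz, a]
    · simp [hz]
  have hmt : advanceMass u (δ / 2) π ≠ ∞ :=
    ne_top_of_le_ne_top ENNReal.one_ne_top (advanceMass_le_one u _ π)
  have hmsum : HasSum (fun z => (if δ / 2 ≤ dot z u then 1 else 0) * a z)
      (advanceMass u (δ / 2) π).toReal := by
    have := ENNReal.hasSum_toReal hmt
    simp only [hind] at this
    convert this using 1
    rw [advanceMass, ENNReal.tsum_toReal_eq fun z => ne_top_of_le_ne_top (π.apply_ne_top z)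
      (Set.indicator_le_self' (fun _ _ => zero_le) z)]
    exact tsum_congr hind
  have hpt : ∑' z : Site d, ENNReal.ofReal (l1norm z ^ p) * π z ≠ ∞ :=
    ne_top_of_le_ne_top ENNReal.ofReal_ne_top hmom
  have hreal : ∀ z : Site d, (ENNReal.ofReal (l1norm z ^ p) * π z).toReal = l1norm z ^ p * a z :=
    fun z => by
      rw [ENNReal.toReal_mul, ENNReal.toReal_ofReal (Real.rpow_nonneg (l1norm_nonneg z) p)]
  have hpsum : Summable fun z : Site d => l1norm z ^ p * a z := by
    have := ENNReal.summable_toReal hpt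
    simpa only [hreal] using this
  have hple : ∑' z : Site d, l1norm z ^ p * a z ≤ M ^ p := by
    have h1 := ENNReal.toReal_mono ENNReal.ofReal_ne_top hmom
    rw [ENNReal.tsum_toReal_eq fun z => ENNReal.ne_top_of_tsum_ne_top hpt z,
      ENNReal.toReal_ofReal (Real.rpow_nonneg hM.le p)] at h1
    simpa only [hreal] using h1
  -- A divergent series has sum `0` by convention, which would contradict `δ ≤ 0`.
  have hdsum : Summable fun z : Site d => dot z u * a z := by
    by_contra hne
    rw [tsum_eq_zero_of_not_summable hne] at hπ
    linarith
  have hbound : ∑' z : Site d, dot z u * a z ≤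
      δ / 2 * 1 + B * (advanceMass u (δ / 2) π).toReal +
        B ^ (1 - p) * C ^ p * ∑' z : Site d, l1norm z ^ p * a z := by
    have hR := ((hasum.mul_left (δ / 2)).add (hmsum.mul_left B)).add
      (hpsum.hasSum.mul_left (B ^ (1 - p) * C ^ p))
    refine hasSum_le (fun z => ?_) hdsum.hasSum hR
    have := mul_le_mul_of_nonneg_right (le_threshold hp hBpos (half_pos hδ) hC (l1norm_nonneg z)
      (hCz z)) (ha z)
    linarith
  have h1 : B ^ (1 - p) * C ^ p * ∑' z : Site d, l1norm z ^ p * a z ≤ δ / 4 :=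
    (mul_le_mul_of_nonneg_left hple (by positivity)).trans hB.le
  have h2 : δ / 4 ≤ B * (advanceMass u (δ / 2) π).toReal := by linarith
  rw [ENNReal.ofReal_le_iff_le_toReal hmt, div_le_iff₀ hBpos]
  linarith

lemma eq_zero_of_tsum_subtype_eq_one {d : ℕ} {u : Fin d → ℝ} (π : PMF (Site d))
    (h : ∑' z : {z : Site d // 0 ≤ dot z u}, π z = 1) (z : Site d) (hz : dot z u < 0) :
    π z = 0 := by
  have hsplit := ENNReal.summable.tsum_add_tsum_compl (s := {z : Site d | 0 ≤ dot z u})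
    (f := π) ENNReal.summable
  rw [π.tsum_coe] at hsplit
  have h' : ∑' z : ({z : Site d | 0 ≤ dot z u} : Set (Site d)), π z = 1 := h
  rw [h'] at hsplit
  have h0 : ∑' z : (({z : Site d | 0 ≤ dot z u}ᶜ : Set (Site d))), π z = 0 := by
    have : (1 : ℝ≥0∞) + ∑' z : (({z : Site d | 0 ≤ dot z u}ᶜ : Set (Site d))), π z = 1 + 0 := by
      rw [hsplit, add_zero]
    exact (ENNReal.add_right_inj ENNReal.one_ne_top).1 this
  exact ENNReal.tsum_eq_zero.1 h0 ⟨z, not_le.2 hz⟩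

lemma exists_goodLaws {d : ℕ} {P : Measure (Env d)} {u : Fin d → ℝ} (hforb : ForbiddenDirection P u)
    (hN : NonNestling P u) {p : ℝ} (hp : 1 < p) (hM : MomentBound P p) :
    ∃ (η : ℝ) (ε : ℝ≥0∞), 0 < η ∧ 0 < ε ∧ ∀ᵐ ω ∂P, ω 0 ∈ goodLaws u η ε := by
  obtain ⟨δ, hδ, hN⟩ := hN
  obtain ⟨M, hM0, hM⟩ := hM
  obtain ⟨ε, hε, h⟩ := exists_le_advanceMass u hp hδ hM0
  refine ⟨δ / 2, ε, half_pos hδ, hε, ?_⟩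
  filter_upwards [hforb, hN, hM] with ω h1 h2 h3
  simp only [jump, sub_zero] at h1 h2 h3
  exact ⟨eq_zero_of_tsum_subtype_eq_one (ω 0) h1, h (ω 0) h2 h3⟩

/-! ### Passing between half-space σ-fields and half-space events -/

lemma upperAbsCont_of_absContOn {d : ℕ} {u : Fin d → ℝ} {μ ν : Measure (Env d)}
    (h : ∀ k : ℤ, k ≤ 0 → AbsContOn (halfSpace u k) μ ν) {a : ℝ} (ha : a ≤ 0) :
    UpperAbsCont u a μ ν := by
  intro A hA hup h0
  have hk : ⌊a⌋ ≤ 0 := by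
    have : (⌊a⌋ : ℝ) ≤ 0 := (Int.floor_le a).trans ha
    exact_mod_cast this
  exact h ⌊a⌋ hk A ((hup.mono (Int.floor_le a)).measurableSet_halfSpace hA) h0

end RWRE

theorem mainTheorem4 {d : ℕ} (hd : 1 ≤ d) (P : Measure (RWRE.Env d)) [IsProbabilityMeasure P]
    (hP : RWRE.IsIIDEnvironment P) (u : Fin d → ℝ) (hu : u ≠ 0)
    (hforb : RWRE.ForbiddenDirection P u) (hN : RWRE.NonNestling P u)
    (p : ℝ) (hp : 1 < p) (hM : RWRE.MomentBound P p) :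
    ∃ Pinf : Measure (RWRE.Env d), IsProbabilityMeasure Pinf ∧
      Kernel.Invariant (RWRE.envKernel d) Pinf ∧
      (∀ k : ℤ, k ≤ 0 → RWRE.AbsContOn (RWRE.halfSpace u k) Pinf P) ∧
      (∀ A : Set (RWRE.Env d), MeasurableSet[RWRE.halfSpace u 1] A → P A = Pinf A) ∧
      (RWRE.AbsContOn (RWRE.halfSpace u 0) P Pinf ∧
        RWRE.AbsContOn (RWRE.halfSpace u 0) Pinf P) ∧
      RWRE.ErgodicEnvChain Pinf ∧
      (∀ Q : Measure (RWRE.Env d), IsProbabilityMeasure Q →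
        Kernel.Invariant (RWRE.envKernel d) Q →
        (∀ k : ℤ, k ≤ 0 → RWRE.AbsContOn (RWRE.halfSpace u k) Q P) →
        RWRE.ErgodicEnvChain Q → Q = Pinf) ∧
      (∀ k : ℤ, k ≤ 0 → ∀ A : Set (RWRE.Env d), MeasurableSet[RWRE.halfSpace u k] A →
        Tendsto (fun n : ℕ => RWRE.envLaw P n A) atTop (𝓝 (Pinf A))) := by
  obtain ⟨η, ε, hη, hε, hgood⟩ := RWRE.exists_goodLaws hforb hN hp hM
  obtain ⟨ω₁, hω₁⟩ := hgood.exists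
  obtain ⟨S, hS⟩ := RWRE.exists_splitting hη hε ⟨_, hω₁⟩
  obtain ⟨Q, hQprob, hQ⟩ := S.exists_stationaryLaw hP
  replace hQ : S.IsStationaryLaw P Q := hQ
  have hG := RWRE.measurableSet_goodLaws (d := d) u η ε
  have hneg : ∀ N : ℕ, -((N : ℝ) * η) ≤ 0 := fun N => neg_nonpos.2 (by positivity)
  have hgoodOf : ∀ {μ : Measure (RWRE.Env d)},
      (∀ N : ℕ, RWRE.UpperAbsCont u (-(N * η)) μ P) → ∀ᵐ ω ∂μ, ∀ x, ω x ∈ RWRE.goodLaws u η ε :=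
    fun h => RWRE.good_of_upperAbsCont hη hP hG hgood h
  have hQG := hgoodOf (hQ.upperAbsCont hP)
  have hpush : ∀ {μ : Measure (RWRE.Env d)}, (∀ᵐ ω ∂μ, ∀ x, ω x ∈ RWRE.goodLaws u η ε) →
      μ.bind (RWRE.envKernel d) = RWRE.push S.full μ := fun h => by
    rw [RWRE.bind_envKernel]
    exact (RWRE.push_congr_of_good S.measurable_full RWRE.measurable_stepWeight hS h).symm
  have hinv : Kernel.Invariant (RWRE.envKernel d) Q := (hpush hQG).trans (hQ.push_full hP)
  have hac : ∀ k : ℤ, k ≤ 0 → RWRE.AbsContOn (RWRE.halfSpace u k) Q P := by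
    intro k _ A hA h0
    obtain ⟨N, hN⟩ := RWRE.exists_nat_neg_mul_le hη k
    exact hQ.upperAbsCont hP N A (RWRE.halfSpace_le u k A hA)
      ((RWRE.isUpper_of_measurableSet hA).mono hN) h0
  refine ⟨Q, hQprob, hinv, hac, fun A hA => ?_, ⟨fun A hA h0 => ?_, hac 0 le_rfl⟩,
    hQ.ergodicEnvChain hP hS hQG hinv, fun Q' hQ' hinv' hac' _ => ?_, fun k _ A hA => ?_⟩
  · exact hQ.apply_eq_of_pos hP one_pos (RWRE.halfSpace_le u 1 A hA)
      (by simpa using RWRE.isUpper_of_measurableSet hA)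
  · have h := hQ.mul_le_apply (RWRE.halfSpace_le u 0 A hA)
      (by simpa using RWRE.isUpper_of_measurableSet hA)
    rw [h0, nonpos_iff_eq_zero, mul_eq_zero] at h
    exact h.resolve_left hε.ne'
  · have hac'' : ∀ N : ℕ, RWRE.UpperAbsCont u (-(N * η)) Q' P := fun N =>
      RWRE.upperAbsCont_of_absContOn hac' (hneg N)
    exact hQ.eq_of_push_full hP hac'' ((hpush (hgoodOf hac'')).symm.trans hinv')
  · obtain ⟨N, hN⟩ := RWRE.exists_nat_neg_mul_le hη k
    have hA' := RWRE.halfSpace_le u k A hA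
    have h := hQ.tendsto_self hP N (RWRE.indicator_one_le A) (measurable_const.indicator hA')
      ((RWRE.isUpper_of_measurableSet hA).mono hN).dependsOn_indicator
    rw [RWRE.lintegral_indicator_const_one _ hA'] at h
    refine h.congr fun n => ?_
    rw [RWRE.envLaw_apply P n hA']
    refine lintegral_congr_ae ?_
    -- The true weights and the split ones agree `P`-almost surely at all sites at once, `P` being
    -- trivially absolutely continuous with respect to itself.
    filter_upwards [hgoodOf fun N A _ _ h => h] with ω hω
    exact RWRE.op_pow_congr_of_good hS n _ hω
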